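/- Let $N\ge 1$, $0<\alpha<1$, $p_F:=1+\frac2N$. Let $h_\alpha$ be the probability density on $(0,\infty)$ with $\int_0^\infty h_\alpha(\theta)e^{z\theta}\,d\theta=\sum_{k\ge0}\frac{z^k}{\Gamma(\alpha k+1)}$ for $z\in\mathbf C$ (the M-Wright function), let $G(t,x)=(4\pi t)^{-N/2}e^{-|x|^2/(4t)}$, $e^{t\Delta}\mu(x)=\int_{\mathbf R^N}G(t,x-y)\,d\mu(y)$ and $$P_\alpha(t)=\int_0^\infty h_\alpha(\theta)\,e^{t^\alpha\theta\Delta}\,d\theta,\qquad S_\alpha(t)=\int_0^\infty \theta h_\alpha(\theta)\,e^{t^\alpha\theta\Delta}\,d\theta .$$ For $0<T<\infty$, $p>1$ and a nonnegative Radon measure $\mu$ on $\mathbf R^N$, a solution in $[0,T]\times\mathbf R^N$ of the problem $$\partial_t^\alpha u-\Delta u=u^p\ \text{ in }(0,T)\times\mathbf R^N,\qquad u(0)=\mu\ \text{ in }\mathbf R^N,\tag{1}$$ where $\partial_t^\alpha$ is the Caputo derivative, is a nonnegative measurable function $u$ on $(0,T]\times\mathbf R^N$ such that $$\infty>u(t,x)=[P_\alpha(t)\mu](x)+\alpha\int_0^t(t-s)^{\alpha-1}[S_\alpha(t-s)u(s)^p](x)\,ds$$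 for almost all $t\in(0,T]$ and $x\in\mathbf R^N$. **Theorem.** For all $N\ge1$, $1<p\le p_F$ and $0<\alpha<1$ there is a constant $\gamma_2=\gamma_2(N,p,\alpha)>0$ with the following properties. (a) For every $T>0$ and every nonnegative Radon measure $\mu$ on $\mathbf R^N$ with $$\sup_{z\in\mathbf R^N}\mu\big(B(z,T^{\alpha/2})\big)\le\gamma_2\,T^{\alpha\left(\frac N2-\frac1{p-1}\right)},$$ problem (1) possesses a solution in $[0,T]\times\mathbf R^N$. (b) If $p\ne p_F$, then $\limsup_{\alpha\to1-0}\gamma_2(N,p,\alpha)\in(0,\infty)$. (c) If $p=p_F$, then there is $C=C(N)>0$ with $\gamma_2(N,p_F,\alpha)\le C(1-\alpha)^{N/2}$ for all $\alpha\in(0,1)$; this order is attained, that is, there is $c=c(N)>0$ with $\gamma_2(N,p_F,\alpha)\ge c\,(1-\alpha)^{N/2}$ for all $\alpha<1$ sufficiently close to $1$. -/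

import Mathlib

open MeasureTheory Set Filter Topology
open scoped ENNReal

namespace TimeFractional

theorem inv_Gamma_rec (y : ℝ) : (Real.Gamma y)⁻¹ = y * (Real.Gamma (y + 1))⁻¹ := by
  rcases eq_or_ne y 0 with rfl | h
  · simp
  · rw [Real.Gamma_add_one h, mul_inv, ← mul_assoc, mul_inv_cancel₀ h, one_mul]

theorem sum_choose_sinc (k : ℕ) : ∀ x : ℝ,
    ∑ j ∈ Finset.range (k + 1), (k.choose j : ℝ) * Real.sinc (Real.pi * (j - x)) =
      k.factorial * (Real.Gamma (1 + x))⁻¹ * (Real.Gamma (1 + k - x))⁻¹ := by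
  induction k with
  | zero =>
    intro x
    rcases eq_or_ne x 0 with rfl | h
    · simp
    · have h1 := Real.Gamma_mul_Gamma_one_sub x
      have h2 : Real.sinc (Real.pi * (-x)) = Real.sin (Real.pi * x) / (Real.pi * x) := by
        rw [mul_neg, Real.sinc_neg, Real.sinc_of_ne_zero (by positivity)]
      simp only [zero_add, Finset.range_one, Finset.sum_singleton, Nat.choose_self, Nat.cast_one,
        Nat.cast_zero, zero_sub, one_mul, Nat.factorial_zero, add_zero]
      rw [h2, add_comm 1 x, Real.Gamma_add_one h, ← mul_inv, mul_assoc, h1]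
      have := Real.pi_ne_zero
      field_simp
  | succ k ih =>
    intro x
    have h := Finset.sum_choose_succ_mul (fun i _ => Real.sinc (Real.pi * ((i : ℝ) - x))) k
    rw [h, ih x]
    have h2 : ∑ i ∈ Finset.range (k + 1), (k.choose i : ℝ) *
        Real.sinc (Real.pi * (((i + 1 : ℕ) : ℝ) - x)) =
        k.factorial * (Real.Gamma (1 + (x - 1)))⁻¹ * (Real.Gamma (1 + k - (x - 1)))⁻¹ := by
      rw [← ih (x - 1)]
      refine Finset.sum_congr rfl fun i _ => ?_
      congr 2
      push_cast; ring
    rw [h2]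
    have e1 := inv_Gamma_rec (1 + k - x)
    have e2 := inv_Gamma_rec x
    rw [show (1 + (x - 1)) = x by ring, e2, e1, show (1 : ℝ) + k - (x - 1) = 1 + k - x + 1 by ring,
      show (1 : ℝ) + ((k + 1 : ℕ) : ℝ) - x = 1 + k - x + 1 by push_cast; ring, add_comm x 1,
      Nat.factorial_succ]
    push_cast
    ring

/-- The trigonometric function in the Kanter--Zolotarev formula for one-sided stable laws. -/
noncomputable def kanter (α φ : ℝ) : ℝ :=
  Real.sin (α * φ) ^ α * Real.sin ((1 - α) * φ) ^ (1 - α) / Real.sin φ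

theorem sin_mul_pos {l φ : ℝ} (h0 : 0 < l) (h1 : l < 1) (hφ : φ ∈ Ioo 0 Real.pi) :
    0 < Real.sin (l * φ) :=
  Real.sin_pos_of_pos_of_lt_pi (mul_pos h0 hφ.1) (by nlinarith [hφ.1, hφ.2])

theorem kanter_pos {α φ : ℝ} (h0 : 0 < α) (h1 : α < 1) (hφ : φ ∈ Ioo 0 Real.pi) :
    0 < kanter α φ := by
  have a := sin_mul_pos h0 h1 hφ
  have b := sin_mul_pos (sub_pos.2 h1) (by linarith : 1 - α < 1) hφ
  have c := Real.sin_pos_of_pos_of_lt_pi hφ.1 hφ.2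
  unfold kanter
  positivity

/-- On the curve `z = (sin (α φ) / sin ((1 - α) φ)) e^{iφ}` the function `(1 + z) z ^ (-α)` is real and equal
to `(kanter α φ)⁻¹`. -/
theorem level_curve {α φ : ℝ} (h0 : 0 < α) (h1 : α < 1) (hφ : φ ∈ Ioo 0 Real.pi) (k : ℕ) :
    ∑ j ∈ Finset.range (k + 1), ((k.choose j : ℝ) : ℂ) *
      Complex.exp (((j : ℝ) - α * k : ℝ) *
        ((Real.log (Real.sin (α * φ) / Real.sin ((1 - α) * φ)) : ℝ) + φ * Complex.I)) =
      (((kanter α φ)⁻¹ ^ k : ℝ) : ℂ) := by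
  have a := sin_mul_pos h0 h1 hφ
  have b := sin_mul_pos (sub_pos.2 h1) (by linarith : 1 - α < 1) hφ
  have c := Real.sin_pos_of_pos_of_lt_pi hφ.1 hφ.2
  set L : ℝ := Real.log (Real.sin (α * φ) / Real.sin ((1 - α) * φ)) with hL
  set w : ℂ := (L : ℝ) + φ * Complex.I with hw
  have key : Complex.exp (-(α * w)) * (Complex.exp w + 1) = ((kanter α φ)⁻¹ : ℝ) := by
    have e1 : Complex.exp w = ((Real.sin (α * φ) / Real.sin ((1 - α) * φ) : ℝ) : ℂ) *
        Complex.exp (φ * Complex.I) := by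
      rw [hw, Complex.exp_add, ← Complex.ofReal_exp, hL, Real.exp_log (by positivity)]
    have e2 : Complex.exp (-(α * w)) = ((Real.exp (-(α * L)) : ℝ) : ℂ) *
        Complex.exp ((-(α * φ) : ℝ) * Complex.I) := by
      rw [hw, Complex.ofReal_exp, ← Complex.exp_add]
      congr 1; push_cast; ring
    have e3 : Complex.exp ((-(α * φ) : ℝ) * Complex.I) * (Complex.exp w + 1) =
        ((Real.sin φ / Real.sin ((1 - α) * φ) : ℝ) : ℂ) := by
      have hb : (Real.sin ((1 - α) * φ) : ℂ) ≠ 0 := by exact_mod_cast b.ne'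
      have e4 : Complex.exp ((-(α * φ) : ℝ) * Complex.I) * Complex.exp (φ * Complex.I) =
          Complex.exp (((1 - α) * φ : ℝ) * Complex.I) := by
        rw [← Complex.exp_add]; congr 1; push_cast; ring
      rw [e1, mul_add, mul_left_comm, e4, Complex.ofReal_div, Complex.ofReal_div, mul_one,
        Complex.exp_mul_I, Complex.exp_mul_I, ← Complex.ofReal_cos, ← Complex.ofReal_cos,
        ← Complex.ofReal_sin, ← Complex.ofReal_sin, Real.cos_neg, Real.sin_neg]
      have e5 : Real.sin φ = Real.sin (α * φ) * Real.cos ((1 - α) * φ) +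
          Real.cos (α * φ) * Real.sin ((1 - α) * φ) := by
        rw [← Real.sin_add]; congr 1; ring
      rw [e5]
      generalize Real.sin ((1 - α) * φ) = s at hb ⊢
      generalize Real.sin (α * φ) = s'
      generalize Real.cos (α * φ) = c'
      generalize Real.cos ((1 - α) * φ) = c''
      push_cast
      field_simp
      ring
    rw [e2, mul_assoc, e3, ← Complex.ofReal_mul]
    congr 1
    rw [kanter, inv_div, hL, ← mul_neg,
      ← Real.log_inv, inv_div, mul_comm α, ← Real.rpow_def_of_pos (by positivity),
      Real.div_rpow b.le a.le, Real.rpow_sub b, Real.rpow_one]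
    field_simp
  have : (((kanter α φ)⁻¹ ^ k : ℝ) : ℂ) = Complex.exp (-(α * w)) ^ k * (Complex.exp w + 1) ^ k := by
    rw [← mul_pow, key]; push_cast; rfl
  rw [this, add_pow, Finset.mul_sum]
  refine Finset.sum_congr rfl fun j _ => ?_
  have e : Complex.exp (((j : ℝ) - α * k : ℝ) * w) =
      Complex.exp (-(α * w)) ^ k * Complex.exp w ^ j := by
    rw [← Complex.exp_nat_mul, ← Complex.exp_nat_mul, ← Complex.exp_add]
    congr 1; push_cast; ring
  rw [e]
  push_cast
  ring

theorem kanter_inv_le {α φ : ℝ} (h0 : 0 < α) (h1 : α < 1) (hφ : φ ∈ Ioo 0 Real.pi) :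
    (kanter α φ)⁻¹ ≤ (α ^ α * (1 - α) ^ (1 - α))⁻¹ := by
  have c := Real.sin_pos_of_pos_of_lt_pi hφ.1 hφ.2
  have aux : ∀ l : ℝ, 0 < l → l < 1 → l * Real.sin φ ≤ Real.sin (l * φ) := by
    intro l hl hl'
    have := strictConcaveOn_sin_Icc.concaveOn.2 (x := 0) (y := φ) ⟨le_rfl, Real.pi_pos.le⟩
      ⟨hφ.1.le, hφ.2.le⟩ (sub_pos.2 hl').le hl.le (by ring)
    simpa using this
  have hb : (0 : ℝ) < 1 - α := by linarith
  have a1 := aux α h0 h1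
  have a2 := aux (1 - α) hb (by linarith)
  refine inv_anti₀ (by positivity) ?_
  rw [kanter, le_div_iff₀ c]
  calc α ^ α * (1 - α) ^ (1 - α) * Real.sin φ
      = (α * Real.sin φ) ^ α * ((1 - α) * Real.sin φ) ^ (1 - α) := by
        rw [Real.mul_rpow h0.le c.le, Real.mul_rpow hb.le c.le]
        have : Real.sin φ = Real.sin φ ^ α * Real.sin φ ^ (1 - α) := by
          rw [← Real.rpow_add c]; simp
        nth_rewrite 1 [this]
        ring
    _ ≤ _ := by
        have : 0 ≤ Real.sin (α * φ) := (by positivity : 0 ≤ α * Real.sin φ).trans a1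
        gcongr

theorem measurable_kanter (α : ℝ) : Measurable (kanter α) := by
  unfold kanter
  fun_prop

theorem integrable_kanter {α : ℝ} (h0 : 0 < α) (h1 : α < 1) (k : ℕ) :
    IntervalIntegrable (fun φ => (kanter α φ)⁻¹ ^ k) volume 0 Real.pi := by
  rw [intervalIntegrable_iff_integrableOn_Ioo_of_le Real.pi_pos.le]
  refine Measure.integrableOn_of_bounded (M := (α ^ α * (1 - α) ^ (1 - α))⁻¹ ^ k) (by simp)
    ((measurable_kanter α).inv.pow_const k).aestronglyMeasurable ?_
  refine (ae_restrict_iff' measurableSet_Ioo).2 (ae_of_all _ fun φ hφ => ?_)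
  have := (kanter_pos h0 h1 hφ).le
  rw [Real.norm_of_nonneg (by positivity)]
  exact pow_le_pow_left₀ (by positivity) (kanter_inv_le h0 h1 hφ) k

theorem integral_kanter {α : ℝ} (h0 : 0 < α) (h1 : α < 1) (k : ℕ) :
    ∫ φ in (0 : ℝ)..Real.pi, (kanter α φ)⁻¹ ^ k = Real.pi * (k.factorial *
      (Real.Gamma (1 + α * k))⁻¹ * (Real.Gamma (1 + (1 - α) * k))⁻¹) := by
  have hb : (0 : ℝ) < 1 - α := by linarith
  set L : ℝ → ℝ := fun φ => Real.log (Real.sin (α * φ) / Real.sin ((1 - α) * φ)) with hL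
  set q : ℝ → ℝ → ℝ := fun m φ => Real.exp (m * L φ) * (φ * Real.sinc (m * φ)) with hq
  set R : ℝ → ℝ := fun φ => α * Real.sinc (α * φ) / ((1 - α) * Real.sinc ((1 - α) * φ)) with hR
  have sinc_eq : ∀ l φ : ℝ, 0 < l → 0 < φ → Real.sin (l * φ) = l * Real.sinc (l * φ) * φ := by
    intro l φ hl hφ
    rw [Real.sinc_of_ne_zero (by positivity)]
    field_simp
  have hLR : ∀ φ, 0 < φ → L φ = Real.log (R φ) := by
    intro φ hφ
    simp only [hL, hR, sinc_eq _ _ h0 hφ, sinc_eq _ _ hb hφ]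
    rw [mul_div_mul_right _ _ hφ.ne']
  have hderiv : ∀ φ ∈ Ioo 0 Real.pi,
      HasDerivAt (fun φ => ∑ j ∈ Finset.range (k + 1), (k.choose j : ℝ) * q (j - α * k) φ)
        ((kanter α φ)⁻¹ ^ k) φ := by
    intro φ hφ
    have a := sin_mul_pos h0 h1 hφ
    have b := sin_mul_pos hb (by linarith : 1 - α < 1) hφ
    obtain ⟨l, hl⟩ : ∃ l, HasDerivAt L l φ := by
      have : DifferentiableAt ℝ L φ := by
        have e : Real.sin (α * φ) / Real.sin ((1 - α) * φ) ≠ 0 := by positivity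
        have e' := b.ne'
        simp only [hL]
        exact DifferentiableAt.log (DifferentiableAt.div (by fun_prop) (by fun_prop) e') e
      exact ⟨_, this.hasDerivAt⟩
    have hqd : ∀ m : ℝ, HasDerivAt (q m)
        (Complex.exp ((m : ℝ) * ((L φ : ℝ) + φ * Complex.I)) * (l + Complex.I)).im φ := by
      intro m
      have e : (Complex.exp ((m : ℝ) * ((L φ : ℝ) + φ * Complex.I)) * (l + Complex.I)).im =
          Real.exp (m * L φ) * (l * Real.sin (m * φ) + Real.cos (m * φ)) := by
        rw [Complex.mul_im, Complex.exp_re, Complex.exp_im]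
        simp
        ring
      rw [e]
      rcases eq_or_ne m 0 with rfl | hm
      · simpa [hq] using hasDerivAt_id' φ
      · have e2 : q m = fun φ => Real.exp (m * L φ) * (Real.sin (m * φ) / m) := by
          funext x
          simp only [hq]
          rcases eq_or_ne x 0 with rfl | hx
          · simp
          · rw [Real.sinc_of_ne_zero (by positivity)]
            field_simp
        rw [e2]
        have d1 := (hl.const_mul m).exp
        have d2 := (((hasDerivAt_id' φ).const_mul m).sin).div_const m
        refine (d1.mul d2).congr_deriv ?_
        field_simp
    have hs := HasDerivAt.fun_sum (u := Finset.range (k + 1))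
      (fun j _ => (hqd (j - α * k)).const_mul (k.choose j : ℝ))
    refine hs.congr_deriv ?_
    have lc := congrArg (fun z : ℂ => (z * (l + Complex.I)).im) (level_curve h0 h1 hφ k)
    simp only [Finset.sum_mul, Complex.im_sum] at lc
    rw [Complex.im_ofReal_mul] at lc
    simp only [mul_assoc, Complex.im_ofReal_mul] at lc
    simpa using lc
  have hRc : ∀ φ ∈ Icc 0 Real.pi, 0 < R φ ∧ ContinuousAt R φ := by
    intro φ hφ
    have pos : ∀ l : ℝ, 0 < l → l < 1 → 0 < Real.sinc (l * φ) := by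
      intro l hl hl'
      rcases hφ.1.eq_or_lt with h | h
      · simp [← h]
      · rw [Real.sinc_of_ne_zero (by positivity)]
        exact div_pos (Real.sin_pos_of_pos_of_lt_pi (by positivity)
          (by nlinarith [hφ.2])) (by positivity)
    have p1 := pos α h0 h1
    have p2 := pos (1 - α) hb (by linarith)
    refine ⟨by simp only [hR]; positivity, ?_⟩
    simp only [hR]
    refine ContinuousAt.div ?_ ?_ (by positivity)
    · have := Real.continuous_sinc; fun_prop
    · have := Real.continuous_sinc; fun_prop
  have hqlim : ∀ φ ∈ Icc 0 Real.pi, Tendsto (fun x => ∑ j ∈ Finset.range (k + 1),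
      (k.choose j : ℝ) * q (j - α * k) x) (𝓟 (Ioi 0) ⊓ 𝓝 φ) (𝓝 (∑ j ∈ Finset.range (k + 1),
      (k.choose j : ℝ) * (Real.exp ((j - α * k) * Real.log (R φ)) *
        (φ * Real.sinc ((j - α * k) * φ))))) := by
    intro φ hφ
    have c : ContinuousAt (fun x => ∑ j ∈ Finset.range (k + 1),
      (k.choose j : ℝ) * (Real.exp ((j - α * k) * Real.log (R x)) *
        (x * Real.sinc ((j - α * k) * x)))) φ := by
      have := Real.continuous_sinc
      have h' := (hRc φ hφ).2
      have h'' := (hRc φ hφ).1.ne'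
      fun_prop (disch := assumption)
    refine (c.tendsto.mono_left inf_le_right).congr' ?_
    refine Filter.Eventually.filter_mono inf_le_left ?_
    refine eventually_principal.2 fun x hx => ?_
    simp only [hq, hLR x hx]
  have hRpi : R Real.pi = 1 := by
    have p := Real.pi_pos
    have s0 := sinc_eq _ _ h0 p
    have s1 := sinc_eq _ _ hb p
    have s2 : Real.sin ((1 - α) * Real.pi) = Real.sin (α * Real.pi) := by
      rw [← Real.sin_pi_sub]; congr 1; ring
    have s3 : α * Real.sinc (α * Real.pi) = (1 - α) * Real.sinc ((1 - α) * Real.pi) :=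
      mul_right_cancel₀ p.ne' (by rw [← s0, ← s1, s2])
    have s4 : 0 < Real.sin (α * Real.pi) :=
      Real.sin_pos_of_pos_of_lt_pi (by positivity) (by nlinarith)
    simp only [hR]
    rw [s3, div_self]
    intro h
    rw [s0, s3, h] at s4
    simp at s4
  have t0 := hqlim 0 ⟨le_rfl, Real.pi_pos.le⟩
  have t1 := hqlim Real.pi ⟨Real.pi_pos.le, le_rfl⟩
  rw [inf_comm] at t0
  have t1' := t1.mono_left (le_inf (le_principal_iff.2
    (mem_nhdsWithin_of_mem_nhds (Ioi_mem_nhds Real.pi_pos))) nhdsWithin_le_nhds :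
    𝓝[<] Real.pi ≤ _)
  rw [intervalIntegral.integral_eq_sub_of_hasDerivAt_of_tendsto Real.pi_pos hderiv
    (integrable_kanter h0 h1 k) t0 t1']
  have h := sum_choose_sinc k (α * k)
  rw [show (1 : ℝ) + k - α * k = 1 + (1 - α) * k by ring] at h
  rw [← h, hRpi, Finset.mul_sum]
  simp only [Real.log_one, mul_zero, Real.exp_zero, one_mul, zero_mul, Finset.sum_const_zero,
    sub_zero]
  refine Finset.sum_congr rfl fun j _ => ?_
  rw [mul_comm (_ - _) Real.pi]
  ring

/-- The probability density `h_α` on `(0, ∞)` (the M-Wright function). It is the density of `S ^ (-α)`, where `S`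
is the one-sided `α`-stable variable with Laplace transform `exp (-s ^ α)`, in its Kanter--Zolotarev integral
representation. The lemmas below show that it is the function determined by the two usual properties:
its moments are `∫ θ ^ k h_α(θ) dθ = k! / Γ(1 + α k)` (in particular its mass is `1`), and
`∫ h_α(θ) e ^ (z θ) dθ = E_{α,1}(z)` for all complex `z` (`wrightDensity_laplace`). -/
noncomputable def wrightDensity (α θ : ℝ) : ℝ :=
  Real.pi⁻¹ * ∫ φ in (0 : ℝ)..Real.pi, (1 - α)⁻¹ * kanter α φ ^ (1 - α)⁻¹ *
    θ ^ (α / (1 - α)) * Real.exp (-(θ * kanter α φ) ^ (1 - α)⁻¹)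

theorem wright_kernel_moment {α b : ℝ} (h0 : 0 < α) (h1 : α < 1) (hb : 0 < b) (k : ℕ) :
    IntegrableOn (fun θ : ℝ => θ ^ k * ((1 - α)⁻¹ * b ^ (1 - α)⁻¹ * θ ^ (α / (1 - α)) *
      Real.exp (-(θ * b) ^ (1 - α)⁻¹))) (Ioi 0) ∧
    ∫ θ in Ioi (0 : ℝ), θ ^ k * ((1 - α)⁻¹ * b ^ (1 - α)⁻¹ * θ ^ (α / (1 - α)) *
      Real.exp (-(θ * b) ^ (1 - α)⁻¹)) = b⁻¹ ^ k * Real.Gamma (1 + (1 - α) * k) := by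
  have hc : (0 : ℝ) < 1 - α := by linarith
  have hcp : (0 : ℝ) < (1 - α)⁻¹ := by positivity
  have e : EqOn (fun θ : ℝ => θ ^ k * ((1 - α)⁻¹ * b ^ (1 - α)⁻¹ * θ ^ (α / (1 - α)) *
      Real.exp (-(θ * b) ^ (1 - α)⁻¹))) (fun θ => ((1 - α)⁻¹ * b ^ (1 - α)⁻¹) *
      (θ ^ (k + α / (1 - α)) * Real.exp (-(b ^ (1 - α)⁻¹) * θ ^ (1 - α)⁻¹))) (Ioi 0) := by
    intro θ hθ
    have hθ : 0 < θ := hθ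
    simp only
    rw [Real.rpow_add hθ, Real.rpow_natCast, Real.mul_rpow hθ.le hb.le]
    ring_nf
  have hq : -1 < (k : ℝ) + α / (1 - α) := by
    have : 0 < α / (1 - α) := by positivity
    have := k.cast_nonneg (α := ℝ)
    linarith
  constructor
  · rw [integrableOn_congr_fun e measurableSet_Ioi]
    refine Integrable.const_mul ?_ _
    exact integrableOn_rpow_mul_exp_neg_mul_rpow hq hcp (by positivity)
  · rw [setIntegral_congr_fun measurableSet_Ioi e, integral_const_mul,
      integral_rpow_mul_exp_neg_mul_rpow hcp hq (by positivity), ← Real.rpow_mul hb.le]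
    have e1 : ((k : ℝ) + α / (1 - α) + 1) / (1 - α)⁻¹ = 1 + (1 - α) * k := by
      field_simp; ring
    have e2 : (1 - α)⁻¹ * (-((k : ℝ) + α / (1 - α) + 1) / (1 - α)⁻¹) = -(1 - α)⁻¹ + -(k : ℝ) := by
      field_simp; ring
    rw [e1, e2, Real.rpow_add hb, Real.rpow_neg hb.le, Real.rpow_neg hb.le, Real.rpow_natCast]
    have : 0 < b ^ (1 - α)⁻¹ := by positivity
    rw [inv_pow]
    field_simp

theorem wright_integrand_measurable (α : ℝ) : Measurable (fun x : ℝ × ℝ =>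
    (1 - α)⁻¹ * kanter α x.2 ^ (1 - α)⁻¹ * x.1 ^ (α / (1 - α)) *
      Real.exp (-(x.1 * kanter α x.2) ^ (1 - α)⁻¹)) := by
  have := measurable_kanter α
  fun_prop

theorem measurable_wrightDensity (α : ℝ) : Measurable (wrightDensity α) := by
  unfold wrightDensity
  refine Measurable.const_mul ?_ _
  simp only [intervalIntegral.integral_of_le Real.pi_pos.le]
  exact (wright_integrand_measurable α).stronglyMeasurable.integral_prod_right'.measurable

theorem wrightDensity_nonneg {α θ : ℝ} (h0 : 0 < α) (h1 : α < 1) (hθ : 0 < θ) :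
    0 ≤ wrightDensity α θ := by
  have hc : (0 : ℝ) < 1 - α := by linarith
  unfold wrightDensity
  rw [intervalIntegral.integral_of_le Real.pi_pos.le, integral_Ioc_eq_integral_Ioo]
  refine mul_nonneg (by positivity) (setIntegral_nonneg measurableSet_Ioo fun φ hφ => ?_)
  have := kanter_pos h0 h1 hφ
  positivity

theorem wrightDensity_moment {α : ℝ} (h0 : 0 < α) (h1 : α < 1) (k : ℕ) :
    IntegrableOn (fun θ => θ ^ k * wrightDensity α θ) (Ioi 0) ∧
    ∫ θ in Ioi (0 : ℝ), θ ^ k * wrightDensity α θ = k.factorial / Real.Gamma (1 + α * k) := by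
  have hc : (0 : ℝ) < 1 - α := by linarith
  set F : ℝ × ℝ → ℝ := fun x => x.1 ^ k * ((1 - α)⁻¹ * kanter α x.2 ^ (1 - α)⁻¹ *
    x.1 ^ (α / (1 - α)) * Real.exp (-(x.1 * kanter α x.2) ^ (1 - α)⁻¹)) with hF
  have hFm : Measurable F := (measurable_fst.pow_const k).mul (wright_integrand_measurable α)
  have hpt : ∀ θ, θ ^ k * wrightDensity α θ = Real.pi⁻¹ * ∫ φ in Ioo 0 Real.pi, F (θ, φ) := by
    intro θ
    rw [wrightDensity, intervalIntegral.integral_of_le Real.pi_pos.le,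
      integral_Ioc_eq_integral_Ioo, mul_left_comm, ← integral_const_mul]
  have hsec : ∀ φ ∈ Ioo 0 Real.pi, IntegrableOn (fun θ => F (θ, φ)) (Ioi 0) ∧
      ∫ θ in Ioi 0, F (θ, φ) = (kanter α φ)⁻¹ ^ k * Real.Gamma (1 + (1 - α) * k) :=
    fun φ hφ => wright_kernel_moment h0 h1 (kanter_pos h0 h1 hφ) k
  have hnn : ∀ φ ∈ Ioo 0 Real.pi, ∀ θ ∈ Ioi (0 : ℝ), ‖F (θ, φ)‖ = F (θ, φ) := by
    intro φ hφ θ hθ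
    have := kanter_pos h0 h1 hφ
    have hθ : 0 < θ := hθ
    refine Real.norm_of_nonneg ?_
    simp only [hF]
    positivity
  have hI : IntegrableOn (fun φ => (kanter α φ)⁻¹ ^ k * Real.Gamma (1 + (1 - α) * k))
      (Ioo 0 Real.pi) :=
    Integrable.mul_const ((intervalIntegrable_iff_integrableOn_Ioo_of_le Real.pi_pos.le).1
      (integrable_kanter h0 h1 k)) _
  have hint : Integrable F ((volume.restrict (Ioi 0)).prod (volume.restrict (Ioo 0 Real.pi))) := by
    rw [integrable_prod_iff' hFm.aestronglyMeasurable]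
    constructor
    · exact (ae_restrict_iff' measurableSet_Ioo).2 (ae_of_all _ fun φ hφ => (hsec φ hφ).1)
    · refine (integrableOn_congr_fun (fun φ hφ => ?_) measurableSet_Ioo).2 hI
      rw [setIntegral_congr_fun measurableSet_Ioi (hnn φ hφ), (hsec φ hφ).2]
  simp only [hpt]
  refine ⟨hint.integral_prod_left.const_mul _, ?_⟩
  rw [integral_const_mul, integral_integral_swap (f := fun θ φ => F (θ, φ)) hint,
    setIntegral_congr_fun measurableSet_Ioo fun φ hφ => (hsec φ hφ).2, integral_mul_const,
    ← integral_Ioc_eq_integral_Ioo, ← intervalIntegral.integral_of_le Real.pi_pos.le,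
    integral_kanter h0 h1]
  have g : 0 < Real.Gamma (1 + (1 - α) * k) := Real.Gamma_pos_of_pos (by positivity)
  have := Real.pi_ne_zero
  field_simp

/-- The Mittag-Leffler function `E_{α,β}`. -/
noncomputable def mittagLeffler (α β : ℝ) (z : ℂ) : ℂ :=
  ∑' k : ℕ, z ^ k / (Real.Gamma (α * k + β) : ℂ)

theorem summable_mittagLeffler {α : ℝ} (h0 : 0 < α) {r : ℝ} (hr : 0 ≤ r) :
    Summable fun k : ℕ => r ^ k / Real.Gamma (1 + α * k) := by
  set R : ℝ := (2 * r + 1) ^ α⁻¹ with hR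
  have hR0 : 0 < R := by positivity
  have hRα : R ^ α = 2 * r + 1 := by
    rw [hR, ← Real.rpow_mul (by positivity), inv_mul_cancel₀ h0.ne', Real.rpow_one]
  have hlow : ∀ k : ℕ, (2 * r + 1) ^ k * Real.exp (-R) ≤ Real.Gamma (1 + α * k) := by
    intro k
    rw [Real.Gamma_eq_integral (by positivity), ← hRα, ← Real.rpow_mul_natCast hR0.le]
    have hi := Real.GammaIntegral_convergent (s := 1 + α * k) (by positivity)
    calc R ^ (α * k) * Real.exp (-R) = ∫ x in Ioi R, R ^ (α * k) * Real.exp (-x) := by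
          rw [integral_const_mul, integral_exp_neg_Ioi]
      _ ≤ ∫ x in Ioi R, Real.exp (-x) * x ^ (1 + α * k - 1) := by
          refine setIntegral_mono_on ?_ (hi.mono_set (Ioi_subset_Ioi hR0.le)) measurableSet_Ioi ?_
          · exact (integrableOn_exp_neg_Ioi R).const_mul _
          · intro x hx
            rw [mul_comm, add_sub_cancel_left]
            gcongr
            exact le_of_lt hx
      _ ≤ _ := by
          refine setIntegral_mono_set hi ?_ (Ioi_subset_Ioi hR0.le).eventuallyLE
          refine (ae_restrict_iff' measurableSet_Ioi).2 (ae_of_all _ fun x hx => ?_)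
          have : 0 < x := hx
          simp only [Pi.zero_apply]
          positivity
  refine Summable.of_nonneg_of_le (f := fun k : ℕ => Real.exp R * (r / (2 * r + 1)) ^ k) ?_ ?_ ?_
  · intro k
    have : 0 < Real.Gamma (1 + α * k) := Real.Gamma_pos_of_pos (by positivity)
    positivity
  · intro k
    have : 0 < Real.Gamma (1 + α * k) := Real.Gamma_pos_of_pos (by positivity)
    have h := hlow k
    rw [Real.exp_neg] at h
    have e := Real.exp_pos R
    rw [div_pow, div_le_iff₀ this]
    calc r ^ k = Real.exp R * (r ^ k / (2 * r + 1) ^ k) *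
          ((2 * r + 1) ^ k * (Real.exp R)⁻¹) := by field_simp
      _ ≤ _ := by gcongr
  · refine (summable_geometric_of_lt_one (by positivity) ?_).mul_left _
    rw [div_lt_one (by positivity)]
    linarith

theorem wrightDensity_laplace {α : ℝ} (h0 : 0 < α) (h1 : α < 1) (z : ℂ) :
    ∫ θ in Ioi (0 : ℝ), (wrightDensity α θ : ℂ) * Complex.exp (z * θ) = mittagLeffler α 1 z := by
  set F : ℕ → ℝ → ℂ := fun k θ => (z ^ k / k.factorial) * ((θ ^ k * wrightDensity α θ : ℝ) : ℂ)
    with hF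
  have hFi : ∀ k, Integrable (F k) (volume.restrict (Ioi 0)) := fun k =>
    ((wrightDensity_moment h0 h1 k).1.ofReal).const_mul _
  have hFn : ∀ k, ∫ θ in Ioi (0 : ℝ), ‖F k θ‖ = ‖z‖ ^ k / Real.Gamma (1 + α * k) := by
    intro k
    have : EqOn (fun θ => ‖F k θ‖) (fun θ => ‖z‖ ^ k / k.factorial * (θ ^ k * wrightDensity α θ))
        (Ioi 0) := by
      intro θ hθ
      have hθ : 0 < θ := hθ
      have := wrightDensity_nonneg h0 h1 hθ
      simp only [hF, norm_mul, norm_div, norm_pow, Complex.norm_real, Complex.norm_natCast]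
      rw [Real.norm_of_nonneg hθ.le, Real.norm_of_nonneg this]
    rw [setIntegral_congr_fun measurableSet_Ioi this, integral_const_mul,
      (wrightDensity_moment h0 h1 k).2]
    field_simp
  have hs := hasSum_integral_of_summable_integral_norm hFi
    (by simpa only [hFn] using summable_mittagLeffler h0 (norm_nonneg z))
  have hexp : ∀ θ : ℝ, ∑' k, F k θ = (wrightDensity α θ : ℂ) * Complex.exp (z * θ) := by
    intro θ
    have h := NormedSpace.expSeries_div_hasSum_exp (𝔸 := ℂ) (z * θ)
    rw [← Complex.exp_eq_exp_ℂ] at h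
    rw [← (h.mul_left (wrightDensity α θ : ℂ)).tsum_eq]
    refine tsum_congr fun k => ?_
    simp only [hF]
    push_cast
    ring
  simp only [hexp] at hs
  rw [← hs.tsum_eq, mittagLeffler]
  refine tsum_congr fun k => ?_
  simp only [hF]
  rw [integral_const_mul, integral_complex_ofReal, (wrightDensity_moment h0 h1 k).2]
  have : (k.factorial : ℂ) ≠ 0 := by exact_mod_cast k.factorial_ne_zero
  push_cast
  rw [add_comm (1 : ℝ)]
  field_simp

/-- The Fujita exponent `1 + 2 / N`. -/
noncomputable def fujitaExponent (N : ℕ) : ℝ := 1 + 2 / (N : ℝ)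

/-- The Gauss kernel `G(t, x)` on `ℝ^N`. -/
noncomputable def heatKernel {N : ℕ} (t : ℝ) (x : EuclideanSpace ℝ (Fin N)) : ℝ :=
  1 / (4 * Real.pi * t) ^ ((N : ℝ) / 2) * Real.exp (-‖x‖ ^ 2 / (4 * t))

/-- `(e^{tΔ} μ)(x)` for a nonnegative measure `μ`, with values in `[0, ∞]`. -/
noncomputable def heatSemigroup {N : ℕ} (t : ℝ) (μ : Measure (EuclideanSpace ℝ (Fin N)))
    (x : EuclideanSpace ℝ (Fin N)) : ℝ≥0∞ :=
  ∫⁻ y, ENNReal.ofReal (heatKernel t (x - y)) ∂μ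

/-- `(P_α(t) μ)(x) = ∫_0^∞ h_α(θ) (e^{t^α θ Δ} μ)(x) dθ`. -/
noncomputable def opP {N : ℕ} (α t : ℝ) (μ : Measure (EuclideanSpace ℝ (Fin N)))
    (x : EuclideanSpace ℝ (Fin N)) : ℝ≥0∞ :=
  ∫⁻ θ in Ioi (0 : ℝ), ENNReal.ofReal (wrightDensity α θ) * heatSemigroup (t ^ α * θ) μ x

/-- `(S_α(t) μ)(x) = ∫_0^∞ θ h_α(θ) (e^{t^α θ Δ} μ)(x) dθ`. -/
noncomputable def opS {N : ℕ} (α t : ℝ) (μ : Measure (EuclideanSpace ℝ (Fin N)))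
    (x : EuclideanSpace ℝ (Fin N)) : ℝ≥0∞ :=
  ∫⁻ θ in Ioi (0 : ℝ), ENNReal.ofReal (θ * wrightDensity α θ) * heatSemigroup (t ^ α * θ) μ x

/-- `u` is a nonnegative solution on `[0, T] × ℝ^N` of `∂_t^α u - Δ u = u ^ p`, `u(0) = μ`: it is measurable on
`(0, T] × ℝ^N`, and for almost all `(t, x)` it is finite and satisfies
`u(t) = P_α(t) μ + α ∫_0^t (t - s) ^ (α - 1) S_α(t - s) (u(s) ^ p) ds`, where the function `u(s) ^ p` is
identified with the measure `u(s) ^ p dx`. The values of `u` for `t ∉ (0, T]` are irrelevant. -/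
structure IsSolution {N : ℕ} (α p T : ℝ) (μ : Measure (EuclideanSpace ℝ (Fin N)))
    (u : ℝ → EuclideanSpace ℝ (Fin N) → ℝ≥0∞) : Prop where
  measurable : Measurable fun q : Ioc (0 : ℝ) T × EuclideanSpace ℝ (Fin N) => u q.1 q.2
  equation : ∀ᵐ q : ℝ × EuclideanSpace ℝ (Fin N) ∂((volume.restrict (Ioc 0 T)).prod volume),
    u q.1 q.2 < ∞ ∧
    u q.1 q.2 = opP α q.1 μ q.2 + ENNReal.ofReal α *
      ∫⁻ s in Ioo 0 q.1, ENNReal.ofReal ((q.1 - s) ^ (α - 1)) *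
        opS α (q.1 - s) (volume.withDensity fun y => u s y ^ p) q.2

end TimeFractional

/-! The argument is a Picard iteration in a ball of the space of functions with sup over t of t^(αβ)
‖u(t)‖ finite, the norm being uniformly local L^p on balls of radius T^(α/2) and β = (N/2)(1 - 1/p),
the heat smoothing exponent from measures to L^p. This choice closes the loop: a bound for u(s) in
uniformly local L^p is exactly a bound for the uniformly local mass of the measure u(s)^p dx, so
`P_α(t) μ` and each `S_α(t - s) (u(s)^p)` obey one and the same estimate (`exists_opP_opS_bound`).

That estimate is uniform in α. The heat semigroup gains (t^α θ)^(-β) up to a cutoff, and Minkowski's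
inequality averages this against h_α(θ) or θ h_α(θ). As β < 1, the required moments of 1 + θ^(-β)
are bounded independently of α (`exists_wrightDensity_moment_bound`).

The Duhamel term then reduces to a beta integral with exponents α(1 - β) and 1 - αβp. Since βp = N(p
- 1)/2 ≤ 1 precisely when p ≤ p_F, both are positive for every α < 1, even at p = p_F. The prefactor
α cancels the first pole, so only 1/(1 - αβp) survives (`exists_duhamel_bound`). Hence the ball is
invariant once (mass)^(p-1) is at most a constant times 1 - αβp, after scaling out T. The iterates
increase, so their supremum solves the equation by monotone convergence; no contraction is needed.

The admissible mass is thus of order (1 - αβp)^(1/(p-1)). At p = p_F this is (1 - α)^(N/2); for p <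
p_F it stays bounded below as α → 1. The function γ₂ is defined by these expressions, so (b) and (c)
can be read off from it. -/

namespace TimeFractional

/-! ### Minkowski's inequality and beta integrals -/

/-- Minkowski's integral inequality, for a family whose `L^p` norms are bounded by a positive finite function. -/
theorem lintegral_rpow_lintegral_le {X Y : Type*} [MeasurableSpace X] [MeasurableSpace Y]
    {ν : Measure X} {κ : Measure Y} [SFinite ν] [SFinite κ] {p : ℝ} (hp : 1 < p)
    {f : Y → X → ℝ≥0∞} (hf : Measurable (Function.uncurry f)) {c : Y → ℝ≥0∞} (hc : Measurable c)
    (hc0 : ∀ᵐ a ∂κ, c a ≠ 0) (hcT : ∀ᵐ a ∂κ, c a ≠ ∞)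
    (h : ∀ᵐ a ∂κ, ∫⁻ x, f a x ^ p ∂ν ≤ c a ^ p) :
    ∫⁻ x, (∫⁻ a, f a x ∂κ) ^ p ∂ν ≤ (∫⁻ a, c a ∂κ) ^ p := by
  have hpp : 0 < p := by linarith
  have hq := Real.HolderConjugate.conjExponent hp
  set q := p.conjExponent with hqdef
  have hq0 : 0 < q := hq.symm.pos
  have hpq : p / q = p - 1 := by
    rw [hqdef, Real.conjExponent]
    field_simp
  -- Hölder is applied to f = (f c^(-1/q)) · c^(1/q). With this weight, integrating in x costs
  -- exactly c a ^ p · c a ^ (1 - p) = c a. The cancellations need c positive and finite almost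
  -- everywhere.
  have pt : ∀ x, (∫⁻ a, f a x ∂κ) ^ p ≤
      (∫⁻ a, f a x ^ p * c a ^ (1 - p) ∂κ) * (∫⁻ a, c a ∂κ) ^ (p - 1) := by
    intro x
    have hfx : Measurable fun a => f a x := hf.comp (measurable_id.prodMk measurable_const)
    have H := ENNReal.lintegral_mul_le_Lp_mul_Lq κ hq
      (f := fun a => f a x * c a ^ (-(1 / q))) (g := fun a => c a ^ (1 / q))
      (hfx.mul (hc.pow_const _)).aemeasurable (hc.pow_const _).aemeasurable
    have e1 : ∫⁻ a, ((fun a => f a x * c a ^ (-(1 / q))) * fun a => c a ^ (1 / q)) a ∂κ =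
        ∫⁻ a, f a x ∂κ := by
      refine lintegral_congr_ae ?_
      filter_upwards [hc0, hcT] with a h0 h1
      simp only [Pi.mul_apply]
      rw [mul_assoc, ← ENNReal.rpow_add _ _ h0 h1]
      simp
    have e2 : ∀ a, (f a x * c a ^ (-(1 / q))) ^ p = f a x ^ p * c a ^ (1 - p) := by
      intro a
      rw [ENNReal.mul_rpow_of_nonneg _ _ hpp.le, ← ENNReal.rpow_mul]
      congr 2
      rw [neg_mul, one_div_mul_eq_div, hpq]
      ring
    have e3 : ∀ a, (c a ^ (1 / q)) ^ q = c a := by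
      intro a
      rw [← ENNReal.rpow_mul, one_div_mul_cancel hq0.ne', ENNReal.rpow_one]
    rw [e1] at H
    simp only [e2, e3] at H
    calc (∫⁻ a, f a x ∂κ) ^ p ≤ _ := ENNReal.rpow_le_rpow H hpp.le
      _ = _ := by
        rw [ENNReal.mul_rpow_of_nonneg _ _ hpp.le, ← ENNReal.rpow_mul, ← ENNReal.rpow_mul,
          one_div_mul_cancel hpp.ne', ENNReal.rpow_one, one_div_mul_eq_div, hpq]
  calc ∫⁻ x, (∫⁻ a, f a x ∂κ) ^ p ∂ν
      ≤ ∫⁻ x, (∫⁻ a, f a x ^ p * c a ^ (1 - p) ∂κ) * (∫⁻ a, c a ∂κ) ^ (p - 1) ∂ν :=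
        lintegral_mono pt
    _ = (∫⁻ a, ∫⁻ x, f a x ^ p * c a ^ (1 - p) ∂ν ∂κ) * (∫⁻ a, c a ∂κ) ^ (p - 1) := by
        have m : Measurable (Function.uncurry fun x a => f a x ^ p * c a ^ (1 - p)) :=
          ((hf.comp measurable_swap).pow_const p).mul ((hc.comp measurable_snd).pow_const _)
        have m' : Measurable fun x => ∫⁻ a, f a x ^ p * c a ^ (1 - p) ∂κ := m.lintegral_prod_right'
        rw [lintegral_mul_const _ m', lintegral_lintegral_swap m.aemeasurable]
    _ ≤ (∫⁻ a, c a ∂κ) * (∫⁻ a, c a ∂κ) ^ (p - 1) := by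
        gcongr ?_ * _
        refine lintegral_mono_ae ?_
        filter_upwards [hc0, hcT, h] with a h0 h1 h2
        have hfa : Measurable fun x => f a x := hf.comp measurable_prodMk_left
        rw [lintegral_mul_const _ (hfa.pow_const p)]
        calc _ ≤ c a ^ p * c a ^ (1 - p) := by gcongr
          _ = c a := by rw [← ENNReal.rpow_add _ _ h0 h1]; simp
    _ = _ := by
        nth_rewrite 1 [← ENNReal.rpow_one (∫⁻ a, c a ∂κ)]
        rw [← ENNReal.rpow_add_of_nonneg _ _ zero_le_one (by linarith)]
        congr 1; ring

theorem lintegral_rpow_sub_one {t b : ℝ} (ht : 0 < t) (hb : 0 < b) :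
    ∫⁻ s in Ioo 0 t, ENNReal.ofReal (s ^ (b - 1)) = ENNReal.ofReal (t ^ b / b) := by
  have hi : IntervalIntegrable (fun s : ℝ => s ^ (b - 1)) volume 0 t :=
    intervalIntegral.intervalIntegrable_rpow' (by linarith)
  rw [intervalIntegrable_iff_integrableOn_Ioo_of_le ht.le] at hi
  rw [← ofReal_integral_eq_lintegral_ofReal hi, ← integral_Ioc_eq_integral_Ioo,
    ← intervalIntegral.integral_of_le ht.le, integral_rpow (Or.inl (by linarith))]
  · rw [sub_add_cancel, Real.zero_rpow hb.ne', sub_zero]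
  · refine (ae_restrict_iff' measurableSet_Ioo).2 (ae_of_all _ fun s hs => ?_)
    exact Real.rpow_nonneg hs.1.le _

theorem lintegral_sub_rpow_sub_one {t b : ℝ} (ht : 0 < t) (hb : 0 < b) :
    ∫⁻ s in Ioo 0 t, ENNReal.ofReal ((t - s) ^ (b - 1)) = ENNReal.ofReal (t ^ b / b) := by
  rw [← lintegral_rpow_sub_one ht hb, ← lintegral_indicator measurableSet_Ioo,
    ← lintegral_indicator measurableSet_Ioo,
    ← lintegral_sub_left_eq_self (indicator (Ioo 0 t) fun s => ENNReal.ofReal (s ^ (b - 1))) t]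
  refine lintegral_congr fun s => ?_
  have : s ∈ Ioo 0 t ↔ t - s ∈ Ioo 0 t := by
    constructor <;> rintro ⟨h1, h2⟩ <;> constructor <;> linarith
  by_cases hs : s ∈ Ioo 0 t
  · rw [indicator_of_mem hs, indicator_of_mem (this.1 hs)]
  · rw [indicator_of_notMem hs, indicator_of_notMem (fun h => hs (this.2 h))]

/-- An upper bound for Euler's beta integral. -/
theorem lintegral_beta_le {t a b : ℝ} (ht : 0 < t) (ha : 0 < a) (ha1 : a ≤ 1) (hb : 0 < b)
    (hb1 : b ≤ 1) :
    ∫⁻ s in Ioo 0 t, ENNReal.ofReal ((t - s) ^ (a - 1) * s ^ (b - 1)) ≤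
      ENNReal.ofReal (2 * t ^ (a + b - 1) * (1 / a + 1 / b)) := by
  -- On each half of the interval the nonsingular factor is at most its value at t/2. This displays
  -- the poles of the beta function as 1/a + 1/b, and the pole in b later determines the order of
  -- γ₂.
  have hpt : ∀ s ∈ Ioo 0 t, ENNReal.ofReal ((t - s) ^ (a - 1) * s ^ (b - 1)) ≤
      ENNReal.ofReal ((t / 2) ^ (a - 1)) * ENNReal.ofReal (s ^ (b - 1)) +
      ENNReal.ofReal ((t / 2) ^ (b - 1)) * ENNReal.ofReal ((t - s) ^ (a - 1)) := by
    intro s hs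
    have h1 : 0 < s := hs.1
    have h2 : 0 < t - s := by linarith [hs.2]
    rw [← ENNReal.ofReal_mul (by positivity), ← ENNReal.ofReal_mul (by positivity),
      ← ENNReal.ofReal_add (by positivity) (by positivity)]
    refine ENNReal.ofReal_le_ofReal ?_
    have p1 : 0 < s ^ (b - 1) := by positivity
    have p2 : 0 < (t - s) ^ (a - 1) := by positivity
    have p3 : 0 < (t / 2) ^ (a - 1) := by positivity
    have p4 : 0 < (t / 2) ^ (b - 1) := by positivity
    rcases le_total s (t / 2) with h | h
    · have : (t - s) ^ (a - 1) ≤ (t / 2) ^ (a - 1) :=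
        Real.rpow_le_rpow_of_nonpos (by positivity) (by linarith) (by linarith)
      have := mul_le_mul_of_nonneg_right this p1.le
      have := mul_pos p4 p2
      linarith
    · have : s ^ (b - 1) ≤ (t / 2) ^ (b - 1) :=
        Real.rpow_le_rpow_of_nonpos (by positivity) (by linarith) (by linarith)
      have := mul_le_mul_of_nonneg_left this p2.le
      have := mul_pos p3 p1
      linarith
  refine (setLIntegral_mono (by fun_prop) hpt).trans ?_
  rw [lintegral_add_left (by fun_prop), lintegral_const_mul _ (by fun_prop),
    lintegral_const_mul _ (by fun_prop), lintegral_rpow_sub_one ht hb,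
    lintegral_sub_rpow_sub_one ht ha, ← ENNReal.ofReal_mul (by positivity),
    ← ENNReal.ofReal_mul (by positivity), ← ENNReal.ofReal_add (by positivity) (by positivity)]
  refine ENNReal.ofReal_le_ofReal ?_
  have half : ∀ x : ℝ, 0 < x → x ≤ 1 → (t / 2) ^ (x - 1) ≤ 2 * t ^ (x - 1) := by
    intro x hx hx1
    rw [Real.div_rpow ht.le (by norm_num), div_eq_mul_inv, ← Real.rpow_neg (by norm_num), mul_comm]
    gcongr
    calc (2 : ℝ) ^ (-(x - 1)) ≤ 2 ^ (1 : ℝ) := by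
          apply Real.rpow_le_rpow_of_exponent_le (by norm_num); linarith
      _ = 2 := by simp
  have e1 : t ^ (a + b - 1) = t ^ (a - 1) * t ^ b := by rw [← Real.rpow_add ht]; ring_nf
  have e2 : t ^ (a + b - 1) = t ^ (b - 1) * t ^ a := by rw [← Real.rpow_add ht]; ring_nf
  calc _ ≤ 2 * t ^ (a - 1) * (t ^ b / b) + 2 * t ^ (b - 1) * (t ^ a / a) := by
        gcongr
        · exact half a ha ha1
        · exact half b hb hb1
    _ = 2 * t ^ (a + b - 1) * (1 / b) + 2 * t ^ (a + b - 1) * (1 / a) := by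
        nth_rewrite 1 [e1]
        rw [e2]; ring
    _ = _ := by ring

/-! ### Moments of h_α, uniformly in α -/

/-- Without integrability the Bochner integral is 0 by convention, so this direction needs no
integrability of the layers of `wrightDensity`. -/
theorem ofReal_integral_le_lintegral {X : Type*} [MeasurableSpace X] {μ : Measure X} {f : X → ℝ}
    (hf : 0 ≤ᵐ[μ] f) : ENNReal.ofReal (∫ x, f x ∂μ) ≤ ∫⁻ x, ENNReal.ofReal (f x) ∂μ := by
  by_cases h : Integrable f μ
  · exact (ofReal_integral_eq_lintegral_ofReal h hf).le
  · simp [integral_undef h]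

/-- Convexity between Γ(1) = Γ(2) = 1 gives Γ(x + 1) ≤ 1; divide by x. -/
theorem Gamma_le_inv {x : ℝ} (h0 : 0 < x) (h1 : x ≤ 1) : Real.Gamma x ≤ 1 / x := by
  have := Real.convexOn_Gamma.2 (x := 1) (y := 2) (by simp) (by simp) (sub_nonneg.2 h1) h0.le
    (by ring)
  simp only [smul_eq_mul, Real.Gamma_one, Real.Gamma_two] at this
  rw [show (1 - x) * 1 + x * 2 = x + 1 by ring, Real.Gamma_add_one h0.ne'] at this
  rw [le_div_iff₀ h0]
  linarith

/-- Log-convexity at 2, the midpoint of 1 + x and 3 - x, gives 1 ≤ Γ(1 + x) Γ(3 - x), while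
convexity on [2, 3] gives Γ(3 - x) ≤ 2. It bounds the first moment 1/Γ(1 + α) of h_α by 2. -/
theorem half_le_Gamma_one_add {x : ℝ} (h0 : 0 < x) (h1 : x < 1) : 1 / 2 ≤ Real.Gamma (1 + x) := by
  have h := Real.convexOn_Gamma.2 (x := 2) (y := 3) (by simp) (by simp) h0.le
    (sub_nonneg.2 h1.le) (by ring)
  have g3 : Real.Gamma 3 = 2 := by
    rw [show (3 : ℝ) = 2 + 1 by norm_num, Real.Gamma_add_one two_ne_zero, Real.Gamma_two, mul_one]
  simp only [smul_eq_mul, Real.Gamma_two, g3] at h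
  rw [show x * 2 + (1 - x) * 3 = 3 - x by ring] at h
  have l := Real.Gamma_mul_add_mul_le_rpow_Gamma_mul_rpow_Gamma (s := 1 + x) (t := 3 - x)
    (a := 1 / 2) (b := 1 / 2) (by linarith) (by linarith) (by norm_num) (by norm_num) (by norm_num)
  rw [show 1 / 2 * (1 + x) + 1 / 2 * (3 - x) = 2 by ring, Real.Gamma_two] at l
  have p1 : 0 < Real.Gamma (1 + x) := Real.Gamma_pos_of_pos (by linarith)
  have p2 : 0 < Real.Gamma (3 - x) := Real.Gamma_pos_of_pos (by linarith)
  rw [← Real.mul_rpow p1.le p2.le] at l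
  have l2 : 1 ≤ Real.Gamma (1 + x) * Real.Gamma (3 - x) := by
    by_contra! hlt
    exact absurd (Real.rpow_lt_one (by positivity) hlt (by norm_num : (0 : ℝ) < 1 / 2)) (not_lt.2 l)
  nlinarith

/-- Both sine powers in the numerator are at most 1. The gain is a majorant free of α. -/
theorem kanter_le {α φ : ℝ} (h0 : 0 < α) (h1 : α < 1) (hφ : φ ∈ Ioo 0 Real.pi) :
    kanter α φ ≤ (Real.sin φ)⁻¹ := by
  have a := sin_mul_pos h0 h1 hφ
  have b := sin_mul_pos (sub_pos.2 h1) (by linarith : 1 - α < 1) hφ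
  have c := Real.sin_pos_of_pos_of_lt_pi hφ.1 hφ.2
  rw [kanter, ← one_div]
  gcongr
  exact mul_le_one₀ (Real.rpow_le_one a.le (Real.sin_le_one _) h0.le) (by positivity)
    (Real.rpow_le_one b.le (Real.sin_le_one _) (by linarith))

/-- By Jordan's inequality and symmetry about π/2, sin φ dominates a multiple of φ(π - φ), so the
integral is at most a convergent beta integral. -/
theorem lintegral_sin_rpow_neg_lt_top {β : ℝ} (h0 : 0 ≤ β) (h1 : β < 1) :
    ∫⁻ φ in Ioo 0 Real.pi, ENNReal.ofReal ((Real.sin φ)⁻¹ ^ β) < ∞ := by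
  have hπ := Real.pi_pos
  have low : ∀ φ ∈ Ioo 0 Real.pi, 2 / Real.pi ^ 2 * ((Real.pi - φ) * φ) ≤ Real.sin φ := by
    have aux : ∀ φ, 0 < φ → φ ≤ Real.pi / 2 →
        2 / Real.pi ^ 2 * ((Real.pi - φ) * φ) ≤ Real.sin φ := by
      intro φ h h'
      refine le_trans ?_ (Real.mul_le_sin h.le h')
      rw [show 2 / Real.pi * φ = 2 / Real.pi ^ 2 * (Real.pi * φ) by field_simp]
      gcongr
      linarith
    intro φ hφ
    rcases le_total φ (Real.pi / 2) with h | h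
    · exact aux φ hφ.1 h
    · have := aux (Real.pi - φ) (by linarith [hφ.2]) (by linarith)
      rw [Real.sin_pi_sub] at this
      convert this using 1
      ring
  have hpt : ∀ φ ∈ Ioo 0 Real.pi, ENNReal.ofReal ((Real.sin φ)⁻¹ ^ β) ≤
      ENNReal.ofReal ((2 / Real.pi ^ 2)⁻¹ ^ β) *
        ENNReal.ofReal ((Real.pi - φ) ^ ((1 - β) - 1) * φ ^ ((1 - β) - 1)) := by
    intro φ hφ
    have p1 : 0 < φ := hφ.1
    have p2 : 0 < Real.pi - φ := by linarith [hφ.2]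
    rw [← ENNReal.ofReal_mul (by positivity)]
    refine ENNReal.ofReal_le_ofReal ?_
    rw [show (1 - β) - 1 = -β by ring, Real.rpow_neg p1.le, Real.rpow_neg p2.le,
      ← Real.inv_rpow p1.le, ← Real.inv_rpow p2.le, ← Real.mul_rpow (by positivity) (by positivity),
      ← Real.mul_rpow (by positivity) (by positivity), ← mul_inv, ← mul_inv]
    have c := Real.sin_pos_of_pos_of_lt_pi hφ.1 hφ.2
    gcongr
    exact low φ hφ
  refine (setLIntegral_mono (by fun_prop) hpt).trans_lt ?_
  rw [lintegral_const_mul _ (by fun_prop)]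
  exact ENNReal.mul_lt_top ENNReal.ofReal_lt_top ((lintegral_beta_le hπ (by linarith) (by linarith)
    (by linarith) (by linarith)).trans_lt ENNReal.ofReal_lt_top)

/-- The moment of order `-β` of one layer of the Kanter--Zolotarev representation. -/
theorem lintegral_wright_kernel_rpow_neg {α b β : ℝ} (h0 : 0 < α) (h1 : α < 1) (hb : 0 < b)
    (hβ0 : 0 ≤ β) (hβ : β < 1) :
    ∫⁻ θ in Ioi (0 : ℝ), ENNReal.ofReal ((1 - α)⁻¹ * b ^ (1 - α)⁻¹ * θ ^ (α / (1 - α)) *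
      Real.exp (-(θ * b) ^ (1 - α)⁻¹)) * ENNReal.ofReal (θ ^ (-β)) ≤
      ENNReal.ofReal (b ^ β * (1 / (1 - β))) := by
  have hc : (0 : ℝ) < 1 - α := by linarith
  have hcp : (0 : ℝ) < (1 - α)⁻¹ := by positivity
  have hq : -1 < -β + α / (1 - α) := by
    have : 0 < α / (1 - α) := by positivity
    linarith
  have e : ∀ θ ∈ Ioi (0 : ℝ), ENNReal.ofReal ((1 - α)⁻¹ * b ^ (1 - α)⁻¹ * θ ^ (α / (1 - α)) *
      Real.exp (-(θ * b) ^ (1 - α)⁻¹)) * ENNReal.ofReal (θ ^ (-β)) =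
      ENNReal.ofReal (((1 - α)⁻¹ * b ^ (1 - α)⁻¹) *
      (θ ^ (-β + α / (1 - α)) * Real.exp (-(b ^ (1 - α)⁻¹) * θ ^ (1 - α)⁻¹))) := by
    intro θ hθ
    have hθ : 0 < θ := hθ
    rw [← ENNReal.ofReal_mul (by positivity), Real.rpow_add hθ, Real.mul_rpow hθ.le hb.le]
    congr 1
    rw [show -(θ ^ (1 - α)⁻¹ * b ^ (1 - α)⁻¹) = -(b ^ (1 - α)⁻¹) * θ ^ (1 - α)⁻¹ by ring]
    ring
  rw [setLIntegral_congr_fun measurableSet_Ioi e, ← ofReal_integral_eq_lintegral_ofReal]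
  · refine ENNReal.ofReal_le_ofReal ?_
    rw [integral_const_mul,
      integral_rpow_mul_exp_neg_mul_rpow hcp hq (by positivity), ← Real.rpow_mul hb.le]
    have e1 : (-β + α / (1 - α) + 1) / (1 - α)⁻¹ = 1 - (1 - α) * β := by
      field_simp; ring
    have e2 : (1 - α)⁻¹ * (-(-β + α / (1 - α) + 1) / (1 - α)⁻¹) = -(1 - α)⁻¹ + β := by
      field_simp; ring
    rw [e1, e2, Real.rpow_add hb, Real.rpow_neg hb.le]
    have hpos : 0 < b ^ (1 - α)⁻¹ := by positivity
    have hx0 : 1 - β ≤ 1 - (1 - α) * β := by nlinarith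
    have hx1 : 1 - (1 - α) * β ≤ 1 := by nlinarith
    -- The Gamma argument lies in [1 - β, 1] whatever α is, which removes α from the bound.
    have hG : Real.Gamma (1 - (1 - α) * β) ≤ 1 / (1 - β) :=
      (Gamma_le_inv (by linarith) hx1).trans (one_div_le_one_div_of_le (by linarith) hx0)
    calc _ = b ^ β * Real.Gamma (1 - (1 - α) * β) := by field_simp
      _ ≤ _ := by gcongr
  · exact Integrable.const_mul (integrableOn_rpow_mul_exp_neg_mul_rpow hq hcp (by positivity)) _
  · refine (ae_restrict_iff' measurableSet_Ioi).2 (ae_of_all _ fun θ hθ => ?_)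
    have hθ : 0 < θ := hθ
    simp only [Pi.zero_apply]
    positivity

/-- Tonelli reduces the moment to the layers at fixed φ, each contributing a multiple of `kanter α φ
^ β`. The point is that α does not occur on the right-hand side. -/
theorem lintegral_wrightDensity_rpow_neg {α β : ℝ} (h0 : 0 < α) (h1 : α < 1) (hβ0 : 0 ≤ β)
    (hβ : β < 1) :
    ∫⁻ θ in Ioi (0 : ℝ), ENNReal.ofReal (wrightDensity α θ) * ENNReal.ofReal (θ ^ (-β)) ≤
      ENNReal.ofReal (Real.pi⁻¹ * (1 / (1 - β))) *
        ∫⁻ φ in Ioo 0 Real.pi, ENNReal.ofReal ((Real.sin φ)⁻¹ ^ β) := by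
  have hc : (0 : ℝ) < 1 - α := by linarith
  have hb1 : (0 : ℝ) < 1 - β := by linarith
  have hπ := Real.pi_pos
  set F : ℝ → ℝ → ℝ := fun θ φ => (1 - α)⁻¹ * kanter α φ ^ (1 - α)⁻¹ *
    θ ^ (α / (1 - α)) * Real.exp (-(θ * kanter α φ) ^ (1 - α)⁻¹) with hF
  have hFm : Measurable (Function.uncurry F) := wright_integrand_measurable α
  have pt : ∀ θ ∈ Ioi (0 : ℝ), ENNReal.ofReal (wrightDensity α θ) * ENNReal.ofReal (θ ^ (-β)) ≤
      ENNReal.ofReal Real.pi⁻¹ *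
        ∫⁻ φ in Ioo 0 Real.pi, ENNReal.ofReal (F θ φ) * ENNReal.ofReal (θ ^ (-β)) := by
    intro θ hθ
    have hθ : 0 < θ := hθ
    rw [lintegral_mul_const _ (by exact (hFm.comp measurable_prodMk_left).ennreal_ofReal), ← mul_assoc]
    gcongr
    rw [wrightDensity, ENNReal.ofReal_mul (by positivity),
      intervalIntegral.integral_of_le hπ.le, integral_Ioc_eq_integral_Ioo]
    gcongr
    refine ofReal_integral_le_lintegral ?_
    refine (ae_restrict_iff' measurableSet_Ioo).2 (ae_of_all _ fun φ hφ => ?_)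
    have := kanter_pos h0 h1 hφ
    simp only [Pi.zero_apply]
    positivity
  have m2 : Measurable (Function.uncurry fun θ φ =>
      ENNReal.ofReal (F θ φ) * ENNReal.ofReal (θ ^ (-β))) :=
    hFm.ennreal_ofReal.mul ((measurable_fst.pow_const (-β)).ennreal_ofReal)
  have m3 : Measurable fun θ => ∫⁻ φ in Ioo 0 Real.pi,
      ENNReal.ofReal (F θ φ) * ENNReal.ofReal (θ ^ (-β)) := m2.lintegral_prod_right'
  refine (setLIntegral_mono (m3.const_mul _) pt).trans ?_
  rw [lintegral_const_mul _ m3, lintegral_lintegral_swap m2.aemeasurable,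
    ENNReal.ofReal_mul (by positivity), mul_assoc]
  gcongr
  rw [← lintegral_const_mul _ (by fun_prop)]
  refine setLIntegral_mono (by fun_prop) fun φ hφ => ?_
  have hk := kanter_pos h0 h1 hφ
  refine (lintegral_wright_kernel_rpow_neg h0 h1 hk hβ0 hβ).trans ?_
  rw [← ENNReal.ofReal_mul (by positivity), mul_comm]
  refine ENNReal.ofReal_le_ofReal ?_
  gcongr
  exact kanter_le h0 h1 hφ

theorem lintegral_pow_mul_wrightDensity {α : ℝ} (h0 : 0 < α) (h1 : α < 1) (k : ℕ) :
    ∫⁻ θ in Ioi (0 : ℝ), ENNReal.ofReal (θ ^ k * wrightDensity α θ) =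
      ENNReal.ofReal (k.factorial / Real.Gamma (1 + α * k)) := by
  rw [← (wrightDensity_moment h0 h1 k).2,
    ofReal_integral_eq_lintegral_ofReal (wrightDensity_moment h0 h1 k).1]
  refine (ae_restrict_iff' measurableSet_Ioi).2 (ae_of_all _ fun θ hθ => ?_)
  have hθ : 0 < θ := hθ
  have := wrightDensity_nonneg h0 h1 hθ
  simp only [Pi.zero_apply]
  positivity

/-- Bounds for the moments of `h_α` that are uniform in `α`. -/
theorem exists_wrightDensity_moment_bound {β : ℝ} (hβ0 : 0 ≤ β) (hβ : β < 1) :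
    ∃ C : ℝ, 0 < C ∧ ∀ α : ℝ, 0 < α → α < 1 →
      (∫⁻ θ in Ioi (0 : ℝ), ENNReal.ofReal (wrightDensity α θ) * ENNReal.ofReal (1 + θ ^ (-β)) ≤
        ENNReal.ofReal C) ∧
      ∫⁻ θ in Ioi (0 : ℝ), ENNReal.ofReal (θ * wrightDensity α θ) * ENNReal.ofReal (1 + θ ^ (-β)) ≤
        ENNReal.ofReal C := by
  set D := ENNReal.ofReal (Real.pi⁻¹ * (1 / (1 - β))) *
        ∫⁻ φ in Ioo 0 Real.pi, ENNReal.ofReal ((Real.sin φ)⁻¹ ^ β) with hD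
  have hDT : D ≠ ∞ :=
    (ENNReal.mul_lt_top ENNReal.ofReal_lt_top (lintegral_sin_rpow_neg_lt_top hβ0 hβ)).ne
  have hDC : ENNReal.ofReal (5 + D.toReal) = 5 + D := by
    rw [ENNReal.ofReal_add (by norm_num) ENNReal.toReal_nonneg, ENNReal.ofReal_toReal hDT]
    simp
  -- D bounds the moment of order -β. The 5 serves the second integral: θ(1 + θ^(-β)) ≤ 2θ + 1, with
  -- first moment at most 2 and mass 1.
  refine ⟨5 + D.toReal, by positivity, fun α h0 h1 => ?_⟩
  rw [hDC]
  have hm := measurable_wrightDensity α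
  have M0 : ∫⁻ θ in Ioi (0 : ℝ), ENNReal.ofReal (wrightDensity α θ) = 1 := by
    simpa using lintegral_pow_mul_wrightDensity h0 h1 0
  have M1 : ∫⁻ θ in Ioi (0 : ℝ), ENNReal.ofReal (θ * wrightDensity α θ) ≤ 2 := by
    have := lintegral_pow_mul_wrightDensity h0 h1 1
    simp only [pow_one, Nat.factorial_one, Nat.cast_one, mul_one] at this
    rw [this, show (2 : ℝ≥0∞) = ENNReal.ofReal 2 by simp]
    refine ENNReal.ofReal_le_ofReal ?_
    have g := half_le_Gamma_one_add h0 h1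
    rw [div_le_iff₀ (by linarith)]
    linarith
  constructor
  · have : ∀ θ ∈ Ioi (0 : ℝ), ENNReal.ofReal (wrightDensity α θ) * ENNReal.ofReal (1 + θ ^ (-β)) =
        ENNReal.ofReal (wrightDensity α θ) +
          ENNReal.ofReal (wrightDensity α θ) * ENNReal.ofReal (θ ^ (-β)) := by
      intro θ hθ
      rw [ENNReal.ofReal_add zero_le_one (Real.rpow_nonneg (le_of_lt hθ) _), mul_add]
      simp
    rw [setLIntegral_congr_fun measurableSet_Ioi this, lintegral_add_left (by fun_prop), M0]
    gcongr
    · norm_num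
    · exact lintegral_wrightDensity_rpow_neg h0 h1 hβ0 hβ
  · have : ∀ θ ∈ Ioi (0 : ℝ),
        ENNReal.ofReal (θ * wrightDensity α θ) * ENNReal.ofReal (1 + θ ^ (-β)) ≤
        2 * ENNReal.ofReal (θ * wrightDensity α θ) + ENNReal.ofReal (wrightDensity α θ) := by
      intro θ hθ
      have hθ : 0 < θ := hθ
      have hw := wrightDensity_nonneg h0 h1 hθ
      rw [show (2 : ℝ≥0∞) = ENNReal.ofReal 2 by simp, ← ENNReal.ofReal_mul (by positivity),
        ← ENNReal.ofReal_mul (by positivity), ← ENNReal.ofReal_add (by positivity) hw]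
      refine ENNReal.ofReal_le_ofReal ?_
      have : θ * θ ^ (-β) ≤ θ + 1 := by
        rcases le_total θ 1 with h | h
        · calc θ * θ ^ (-β) = θ ^ (1 - β) := by
                rw [sub_eq_add_neg, Real.rpow_add hθ, Real.rpow_one]
            _ ≤ 1 := Real.rpow_le_one hθ.le h (by linarith)
            _ ≤ _ := by linarith
        · have := Real.rpow_le_one_of_one_le_of_nonpos h (by linarith : -β ≤ 0)
          nlinarith
      have := mul_le_mul_of_nonneg_right this hw
      nlinarith
    refine (setLIntegral_mono (by fun_prop) this).trans ?_
    rw [lintegral_add_left (by fun_prop), lintegral_const_mul _ (by fun_prop), M0]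
    calc 2 * _ + 1 ≤ 2 * 2 + 1 := by gcongr
      _ = (5 : ℝ≥0∞) := by norm_num
      _ ≤ _ := le_self_add

/-! ### The heat semigroup on uniformly local measures -/

variable {N : ℕ}

theorem measurable_heatKernel : Measurable fun q : ℝ × EuclideanSpace ℝ (Fin N) =>
    heatKernel q.1 q.2 := by
  unfold heatKernel
  fun_prop

theorem heatKernel_nonneg {t : ℝ} (ht : 0 < t) (x : EuclideanSpace ℝ (Fin N)) :
    0 ≤ heatKernel t x := by
  unfold heatKernel
  positivity

theorem lintegral_heatKernel {t : ℝ} (ht : 0 < t) :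
    ∫⁻ x : EuclideanSpace ℝ (Fin N), ENNReal.ofReal (heatKernel t x) = 1 := by
  have h := GaussianFourier.integral_rexp_neg_mul_sq_norm (V := EuclideanSpace ℝ (Fin N))
    (b := 1 / (4 * t)) (by positivity)
  have e : ∀ x : EuclideanSpace ℝ (Fin N), heatKernel t x =
      1 / (4 * Real.pi * t) ^ ((N : ℝ) / 2) * Real.exp (-(1 / (4 * t)) * ‖x‖ ^ 2) := by
    intro x
    rw [heatKernel]
    congr 2
    ring
  have hpos : 0 < (4 * Real.pi * t) ^ ((N : ℝ) / 2) := by positivity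
  have h1 : ∫ x : EuclideanSpace ℝ (Fin N), heatKernel t x = 1 := by
    simp only [e]
    rw [integral_const_mul, h, finrank_euclideanSpace_fin,
      show Real.pi / (1 / (4 * t)) = 4 * Real.pi * t by field_simp]
    field_simp
  rw [← ofReal_integral_eq_lintegral_ofReal _ (ae_of_all _ (heatKernel_nonneg ht)), h1,
    ENNReal.ofReal_one]
  -- Integrability comes for free: a nonintegrable kernel would have Bochner integral 0, not 1.
  by_contra hn
  rw [integral_undef hn] at h1
  exact zero_ne_one h1

theorem measurable_heatSemigroup_comp {X : Type*} [MeasurableSpace X]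
    (ν : Measure (EuclideanSpace ℝ (Fin N))) [SFinite ν] {f : X → ℝ}
    {g : X → EuclideanSpace ℝ (Fin N)} (hf : Measurable f) (hg : Measurable g) :
    Measurable fun a => heatSemigroup (f a) ν (g a) := by
  have : Measurable fun r : X × EuclideanSpace ℝ (Fin N) =>
      ENNReal.ofReal (heatKernel (f r.1) (g r.1 - r.2)) :=
    (measurable_heatKernel.comp ((hf.comp measurable_fst).prodMk
      ((hg.comp measurable_fst).sub measurable_snd))).ennreal_ofReal
  exact this.lintegral_prod_right'

/-- The heat semigroup does not increase the uniformly local mass. -/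
theorem setLIntegral_heatSemigroup_le {ν : Measure (EuclideanSpace ℝ (Fin N))} [SFinite ν]
    {A : ℝ≥0∞} {R s : ℝ} (hs : 0 < s) (hA : ∀ z, ν (Metric.ball z R) ≤ A)
    (z : EuclideanSpace ℝ (Fin N)) :
    ∫⁻ x in Metric.ball z R, heatSemigroup s ν x ≤ A := by
  have hk : Measurable fun x : EuclideanSpace ℝ (Fin N) => ENNReal.ofReal (heatKernel s x) :=
    (measurable_heatKernel.comp measurable_prodMk_left).ennreal_ofReal
  have hI : Measurable (indicator (Metric.ball z R) (1 : EuclideanSpace ℝ (Fin N) → ℝ≥0∞)) :=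
    measurable_one.indicator Metric.isOpen_ball.measurableSet
  calc ∫⁻ x in Metric.ball z R, heatSemigroup s ν x
      = ∫⁻ x, ∫⁻ y, indicator (Metric.ball z R) 1 x * ENNReal.ofReal (heatKernel s (x - y)) ∂ν := by
        rw [← lintegral_indicator Metric.isOpen_ball.measurableSet]
        refine lintegral_congr fun x => ?_
        have hx : Measurable fun y => ENNReal.ofReal (heatKernel s (x - y)) :=
          hk.comp (measurable_const.sub measurable_id)
        rw [lintegral_const_mul _ hx]
        by_cases hx : x ∈ Metric.ball z R <;> simp [hx, heatSemigroup]
    _ = ∫⁻ y, ∫⁻ x, indicator (Metric.ball z R) 1 x *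
          ENNReal.ofReal (heatKernel s (x - y)) ∂volume ∂ν := by
        refine lintegral_lintegral_swap (Measurable.aemeasurable ?_)
        exact (hI.comp measurable_fst).mul (hk.comp (measurable_fst.sub measurable_snd))
    _ = ∫⁻ y, ∫⁻ w, indicator (Metric.ball z R) 1 (w + y) *
          ENNReal.ofReal (heatKernel s w) ∂volume ∂ν := by
        refine lintegral_congr fun y => ?_
        rw [← lintegral_sub_right_eq_self (fun w => indicator (Metric.ball z R) 1 (w + y) *
          ENNReal.ofReal (heatKernel s w)) y]
        simp only [sub_add_cancel]
    _ = ∫⁻ w, ∫⁻ y, indicator (Metric.ball z R) 1 (w + y) *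
          ENNReal.ofReal (heatKernel s w) ∂ν := by
        refine lintegral_lintegral_swap (Measurable.aemeasurable ?_)
        exact (hI.comp (measurable_snd.add measurable_fst)).mul (hk.comp measurable_snd)
    -- For fixed displacement w, the ν-integral is the mass of the translated ball centred at z - w,
    -- hence at most A.
    _ ≤ ∫⁻ w, A * ENNReal.ofReal (heatKernel s w) := by
        refine lintegral_mono fun w => ?_
        have hw : Measurable fun y => indicator (Metric.ball z R)
            (1 : EuclideanSpace ℝ (Fin N) → ℝ≥0∞) (w + y) :=
          hI.comp (measurable_const.add measurable_id)
        rw [lintegral_mul_const _ hw]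
        gcongr
        have : ∀ y, indicator (Metric.ball z R) (1 : EuclideanSpace ℝ (Fin N) → ℝ≥0∞) (w + y) =
            indicator (Metric.ball (z - w) R) 1 y := by
          intro y
          have : w + y ∈ Metric.ball z R ↔ y ∈ Metric.ball (z - w) R := by
            rw [mem_ball_iff_norm, mem_ball_iff_norm, show w + y - z = y - (z - w) by abel]
          by_cases hy : y ∈ Metric.ball (z - w) R
          · rw [indicator_of_mem hy, indicator_of_mem (this.2 hy)]; rfl
          · rw [indicator_of_notMem hy, indicator_of_notMem (fun h => hy (this.1 h))]
        simp only [this]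
        rw [lintegral_indicator_one Metric.isOpen_ball.measurableSet]
        exact hA _
    _ = A := by rw [lintegral_const_mul _ hk, lintegral_heatKernel hs, mul_one]

/-- Since ‖x'‖² ≤ 2‖x‖² + 2s, doubling the time absorbs a shift of length at most √s, at the price
of a constant. This allows a pointwise value of the semigroup to be replaced by a local average. -/
theorem heatKernel_le_of_sq_le {s : ℝ} (hs : 0 < s) {x x' : EuclideanSpace ℝ (Fin N)}
    (h : ‖x - x'‖ ^ 2 ≤ s) :
    heatKernel s x ≤ 2 ^ ((N : ℝ) / 2) * Real.exp (1 / 4) * heatKernel (2 * s) x' := by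
  have h2 : ‖x'‖ ^ 2 ≤ 2 * ‖x‖ ^ 2 + 2 * s := by
    have : ‖x'‖ ≤ ‖x‖ + ‖x - x'‖ := by
      have := norm_sub_le x (x - x')
      simpa using this
    nlinarith [norm_nonneg x, norm_nonneg x', norm_nonneg (x - x'), sq_nonneg (‖x‖ - ‖x - x'‖)]
  rw [heatKernel, heatKernel, show 4 * Real.pi * (2 * s) = 2 * (4 * Real.pi * s) by ring,
    Real.mul_rpow (x := 2) (by norm_num) (by positivity)]
  have hp : 0 < (4 * Real.pi * s) ^ ((N : ℝ) / 2) := by positivity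
  have h2p : 0 < (2 : ℝ) ^ ((N : ℝ) / 2) := by positivity
  calc 1 / (4 * Real.pi * s) ^ ((N : ℝ) / 2) * Real.exp (-‖x‖ ^ 2 / (4 * s))
      ≤ 1 / (4 * Real.pi * s) ^ ((N : ℝ) / 2) *
        Real.exp (1 / 4 + -‖x'‖ ^ 2 / (4 * (2 * s))) := by
        gcongr
        rw [← sub_nonneg]
        have : 1 / 4 + -‖x'‖ ^ 2 / (4 * (2 * s)) - -‖x‖ ^ 2 / (4 * s) =
            (2 * ‖x‖ ^ 2 + 2 * s - ‖x'‖ ^ 2) / (8 * s) := by field_simp; ring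
        rw [this]
        exact div_nonneg (by linarith) (by positivity)
    _ = _ := by
        rw [Real.exp_add]
        field_simp

/-- The smoothing effect of the heat semigroup from uniformly local measures to `L^∞`. -/
theorem exists_heatSemigroup_le (hN : 1 ≤ N) :
    ∃ D : ℝ, 0 < D ∧ ∀ (ν : Measure (EuclideanSpace ℝ (Fin N))) [SFinite ν] (A : ℝ≥0∞)
      (R s ρ : ℝ), 0 < ρ → ρ ≤ R → ρ ^ 2 ≤ s → (∀ z, ν (Metric.ball z R) ≤ A) →
      ∀ x, heatSemigroup s ν x ≤ ENNReal.ofReal (D * ρ ^ (-(N : ℝ))) * A := by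
  have : Nonempty (Fin N) := ⟨⟨0, hN⟩⟩
  set ω := volume (Metric.ball (0 : EuclideanSpace ℝ (Fin N)) 1) with hω
  have hω0 : ω ≠ 0 := (Metric.measure_ball_pos _ _ one_pos).ne'
  have hωT : ω ≠ ∞ := measure_ball_lt_top.ne
  have hωp : 0 < ω.toReal := ENNReal.toReal_pos hω0 hωT
  set C : ℝ := 2 ^ ((N : ℝ) / 2) * Real.exp (1 / 4) with hC
  have hCp : 0 < C := by positivity
  refine ⟨C / ω.toReal, by positivity, fun ν _ A R s ρ hρ hρR hρs hA x => ?_⟩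
  have hs : 0 < s := lt_of_lt_of_le (by positivity) hρs
  -- The value at x is compared with the values at time 2s on the ball of radius ρ ≤ √s. Their
  -- integral is at most the local mass on the larger ball of radius R.
  have key : heatSemigroup s ν x * volume (Metric.ball x ρ) ≤ ENNReal.ofReal C * A := by
    calc heatSemigroup s ν x * volume (Metric.ball x ρ)
        = ∫⁻ _ in Metric.ball x ρ, heatSemigroup s ν x := by simp
      _ ≤ ∫⁻ x' in Metric.ball x ρ, ENNReal.ofReal C * heatSemigroup (2 * s) ν x' := by
          refine setLIntegral_mono' Metric.isOpen_ball.measurableSet fun x' hx' => ?_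
          have hk : Measurable fun y => ENNReal.ofReal (heatKernel (2 * s) (x' - y)) :=
            (measurable_heatKernel.comp (measurable_const.prodMk
              (measurable_const.sub measurable_id))).ennreal_ofReal
          rw [heatSemigroup, heatSemigroup, ← lintegral_const_mul _ hk]
          refine lintegral_mono fun y => ?_
          rw [← ENNReal.ofReal_mul hCp.le]
          refine ENNReal.ofReal_le_ofReal (heatKernel_le_of_sq_le hs ?_)
          rw [sub_sub_sub_cancel_right, norm_sub_rev, ← dist_eq_norm]
          refine le_trans ?_ hρs
          gcongr
          exact (Metric.mem_ball.1 hx').le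
      _ ≤ ∫⁻ x' in Metric.ball x R, ENNReal.ofReal C * heatSemigroup (2 * s) ν x' :=
          lintegral_mono_set (Metric.ball_subset_ball hρR)
      _ ≤ _ := by
          rw [lintegral_const_mul _ (measurable_heatSemigroup_comp ν measurable_const measurable_id')]
          gcongr
          exact setLIntegral_heatSemigroup_le (by positivity) hA x
  have hv : volume (Metric.ball x ρ) = ENNReal.ofReal (ρ ^ N * ω.toReal) := by
    rw [Measure.addHaar_ball _ _ hρ.le, finrank_euclideanSpace_fin,
      ENNReal.ofReal_mul (by positivity), ENNReal.ofReal_toReal hωT]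
  have hb : 0 < ρ ^ N * ω.toReal := by positivity
  rw [hv, ← ENNReal.le_div_iff_mul_le (Or.inl (by simpa using hb)) (Or.inl ENNReal.ofReal_ne_top)]
    at key
  refine key.trans (le_of_eq ?_)
  rw [ENNReal.mul_div_right_comm, ← ENNReal.ofReal_div_of_pos hb, Real.rpow_neg hρ.le,
    Real.rpow_natCast]
  congr 2
  field_simp

/-- The smoothing effect of the heat semigroup from uniformly local measures to uniformly local `L^p`. -/
theorem exists_setLIntegral_heatSemigroup_rpow_le (hN : 1 ≤ N) {p β : ℝ} (hp : 1 < p)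
    (hβ : 2 * β * p = N * (p - 1)) :
    ∃ C : ℝ, 0 < C ∧ ∀ (ν : Measure (EuclideanSpace ℝ (Fin N))) [SFinite ν] (A : ℝ≥0∞)
      (R s ρ : ℝ), 0 < ρ → ρ ≤ R → ρ ^ 2 ≤ s → (∀ z, ν (Metric.ball z R) ≤ A) →
      ∀ z, ∫⁻ x in Metric.ball z R, heatSemigroup s ν x ^ p ≤
        (ENNReal.ofReal (C * ρ ^ (-(2 * β))) * A) ^ p := by
  obtain ⟨D, hD, H⟩ := exists_heatSemigroup_le hN
  have hp0 : 0 < p := by linarith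
  -- Interpolation between sup bound and local mass: f^p ≤ (sup f)^(p-1) f. The sup bound enters
  -- with power p - 1, whence the exponent (p - 1)/p after taking p-th roots.
  refine ⟨D ^ ((p - 1) / p), by positivity, fun ν _ A R s ρ hρ hρR hρs hA z => ?_⟩
  have hs : 0 < s := lt_of_lt_of_le (by positivity) hρs
  have hsplit : ∀ a : ℝ≥0∞, a ^ p = a ^ (p - 1) * a := by
    intro a
    nth_rewrite 3 [← ENNReal.rpow_one a]
    rw [← ENNReal.rpow_add_of_nonneg _ _ (by linarith) zero_le_one, sub_add_cancel]
  calc ∫⁻ x in Metric.ball z R, heatSemigroup s ν x ^ p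
      ≤ ∫⁻ x in Metric.ball z R, (ENNReal.ofReal (D * ρ ^ (-(N : ℝ))) * A) ^ (p - 1) *
          heatSemigroup s ν x := by
        refine lintegral_mono fun x => ?_
        simp only
        rw [hsplit]
        gcongr
        exact H ν A R s ρ hρ hρR hρs hA x
    _ ≤ (ENNReal.ofReal (D * ρ ^ (-(N : ℝ))) * A) ^ (p - 1) * A := by
        rw [lintegral_const_mul _ (measurable_heatSemigroup_comp ν measurable_const measurable_id')]
        gcongr
        exact setLIntegral_heatSemigroup_le hs hA z
    _ = _ := by
        rw [ENNReal.mul_rpow_of_nonneg _ _ (by linarith), ENNReal.mul_rpow_of_nonneg _ _ hp0.le,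
          mul_assoc, ← hsplit, ENNReal.ofReal_rpow_of_pos (by positivity),
          ENNReal.ofReal_rpow_of_pos (by positivity), Real.mul_rpow hD.le (by positivity),
          Real.mul_rpow (by positivity) (by positivity), ← Real.rpow_mul hD.le,
          ← Real.rpow_mul hρ.le, ← Real.rpow_mul hρ.le, div_mul_cancel₀ _ hp0.ne',
          show -(N : ℝ) * (p - 1) = -(2 * β) * p by rw [neg_mul, ← hβ]; ring]

/-- The smoothing effect of averages of the heat semigroup. -/
theorem exists_setLIntegral_average_heatSemigroup_le (hN : 1 ≤ N) {p β : ℝ} (hp : 1 < p)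
    (hβ : 2 * β * p = N * (p - 1)) :
    ∃ C : ℝ, 0 < C ∧ ∀ (ν : Measure (EuclideanSpace ℝ (Fin N))) [SFinite ν] (A : ℝ≥0∞)
      (α t T : ℝ) (w : ℝ → ℝ≥0∞), A ≠ 0 → A ≠ ∞ → 0 < α → 0 < t → t ≤ T → Measurable w →
      (∀ z, ν (Metric.ball z (T ^ (α / 2))) ≤ A) →
      ∀ z, ∫⁻ x in Metric.ball z (T ^ (α / 2)),
          (∫⁻ θ in Ioi 0, w θ * heatSemigroup (t ^ α * θ) ν x) ^ p ≤
        (ENNReal.ofReal (C * t ^ (-(α * β))) * A *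
          ∫⁻ θ in Ioi 0, w θ * ENNReal.ofReal (1 + θ ^ (-β))) ^ p := by
  obtain ⟨C, hC, H⟩ := exists_setLIntegral_heatSemigroup_rpow_le hN hp hβ
  have hβ0 : 0 ≤ β := by
    have : 0 ≤ β * (2 * p) := by
      rw [show β * (2 * p) = N * (p - 1) by linarith]
      have : 0 ≤ p - 1 := by linarith
      positivity
    exact nonneg_of_mul_nonneg_left this (by linarith)
  refine ⟨C, hC, fun ν _ A α t T w hA0 hAT hα ht htT hw hA z => ?_⟩
  -- The weight is absorbed into the measure, so that Minkowski's bounding function stays positive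
  -- and finite even where w is 0 or ∞.
  set κ := (volume.restrict (Ioi (0 : ℝ))).withDensity w with hκ
  have hpos : ∀ᵐ θ ∂κ, 0 < θ :=
    (withDensity_absolutelyContinuous _ _).ae_le (ae_restrict_mem measurableSet_Ioi)
  have hf : Measurable (Function.uncurry fun θ x => heatSemigroup (t ^ α * θ) ν x) :=
    measurable_heatSemigroup_comp ν (measurable_fst.const_mul _) measurable_snd
  have hcm : Measurable fun θ : ℝ =>
      ENNReal.ofReal (C * t ^ (-(α * β))) * A * ENNReal.ofReal (1 + θ ^ (-β)) := by fun_prop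
  have M := lintegral_rpow_lintegral_le (ν := volume.restrict (Metric.ball z (T ^ (α / 2))))
    (κ := κ) hp hf hcm ?_ ?_ ?_
  · have e1 : ∀ x, ∫⁻ θ, heatSemigroup (t ^ α * θ) ν x ∂κ =
        ∫⁻ θ in Ioi 0, w θ * heatSemigroup (t ^ α * θ) ν x := fun x =>
      lintegral_withDensity_eq_lintegral_mul _ hw
        (measurable_heatSemigroup_comp ν (measurable_id.const_mul _) measurable_const)
    rw [hκ, lintegral_const_mul _ (by fun_prop),
      lintegral_withDensity_eq_lintegral_mul _ hw (by fun_prop)] at M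
    simp only [← hκ, e1] at M
    exact M
  · filter_upwards [hpos] with θ hθ
    refine mul_ne_zero (mul_ne_zero ?_ hA0) ?_
    · simp only [ne_eq, ENNReal.ofReal_eq_zero, not_le]; positivity
    · simp only [ne_eq, ENNReal.ofReal_eq_zero, not_le]; positivity
  · exact ae_of_all _ fun θ => ENNReal.mul_ne_top (ENNReal.mul_ne_top ENNReal.ofReal_ne_top hAT)
      ENNReal.ofReal_ne_top
  · filter_upwards [hpos] with θ hθ
    -- The radius ρ = t^(α/2) √(min 1 θ) respects both ρ² ≤ t^α θ and ρ ≤ T^(α/2). Its power ρ^(-2β)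
    -- = t^(-αβ) (min 1 θ)^(-β) produces the weight 1 + θ^(-β).
    have hmin : 0 < min 1 θ := lt_min one_pos hθ
    have hρ2 : (t ^ (α / 2) * √(min 1 θ)) ^ 2 = t ^ α * min 1 θ := by
      rw [mul_pow, Real.sq_sqrt hmin.le, ← Real.rpow_mul_natCast ht.le]
      norm_num
    have hρ : 0 < t ^ (α / 2) * √(min 1 θ) := by positivity
    refine (H ν A (T ^ (α / 2)) (t ^ α * θ) (t ^ (α / 2) * √(min 1 θ)) hρ ?_ ?_ hA z).trans ?_
    · calc t ^ (α / 2) * √(min 1 θ) ≤ T ^ (α / 2) * 1 := by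
            have : 0 < T := ht.trans_le htT
            gcongr
            exact Real.sqrt_le_one.2 (min_le_left _ _)
        _ = _ := mul_one _
    · rw [hρ2]
      gcongr
      exact min_le_right _ _
    · have e : (t ^ (α / 2) * √(min 1 θ)) ^ (-(2 * β)) = t ^ (-(α * β)) * (min 1 θ) ^ (-β) := by
        rw [show -(2 * β) = ((2 : ℕ) : ℝ) * (-β) by push_cast; ring, Real.rpow_mul hρ.le,
          Real.rpow_natCast, hρ2, Real.mul_rpow (by positivity) hmin.le, ← Real.rpow_mul ht.le]
        congr 2; ring
      rw [e, ← mul_assoc, ENNReal.ofReal_mul (by positivity), mul_right_comm]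
      gcongr
      have : 0 < θ ^ (-β) := by positivity
      rcases le_total 1 θ with h | h
      · rw [min_eq_left h, Real.one_rpow]; linarith
      · rw [min_eq_right h]; linarith

/-! ### The integral equation as a monotone map, and its Picard iterates -/

/-- The right-hand side of the integral equation. -/
noncomputable def mildMap (α p : ℝ) (μ : Measure (EuclideanSpace ℝ (Fin N)))
    (u : ℝ → EuclideanSpace ℝ (Fin N) → ℝ≥0∞) (t : ℝ) (x : EuclideanSpace ℝ (Fin N)) : ℝ≥0∞ :=
  opP α t μ x + ENNReal.ofReal α * ∫⁻ s in Ioo 0 t, ENNReal.ofReal ((t - s) ^ (α - 1)) *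
    opS α (t - s) (volume.withDensity fun y => u s y ^ p) x

theorem heatSemigroup_withDensity (t : ℝ) {f : EuclideanSpace ℝ (Fin N) → ℝ≥0∞}
    (hf : Measurable f) (x : EuclideanSpace ℝ (Fin N)) :
    heatSemigroup t (volume.withDensity f) x =
      ∫⁻ y, f y * ENNReal.ofReal (heatKernel t (x - y)) := by
  have hk : Measurable fun y => ENNReal.ofReal (heatKernel t (x - y)) :=
    (measurable_heatKernel.comp (measurable_const.prodMk
      (measurable_const.sub measurable_id))).ennreal_ofReal
  rw [heatSemigroup, lintegral_withDensity_eq_lintegral_mul _ hf hk]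
  rfl

theorem measurable_heatSemigroup_withDensity {X : Type*} [MeasurableSpace X] {f : X → ℝ}
    {F : X → EuclideanSpace ℝ (Fin N) → ℝ≥0∞} {g : X → EuclideanSpace ℝ (Fin N)}
    (hf : Measurable f) (hF : Measurable (Function.uncurry F)) (hg : Measurable g) :
    Measurable fun a => heatSemigroup (f a) (volume.withDensity (F a)) (g a) := by
  have e : ∀ a, heatSemigroup (f a) (volume.withDensity (F a)) (g a) =
      ∫⁻ y, F a y * ENNReal.ofReal (heatKernel (f a) (g a - y)) := fun a =>
    heatSemigroup_withDensity _ (hF.comp measurable_prodMk_left) _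
  simp only [e]
  have : Measurable fun r : X × EuclideanSpace ℝ (Fin N) =>
      F r.1 r.2 * ENNReal.ofReal (heatKernel (f r.1) (g r.1 - r.2)) :=
    hF.mul (measurable_heatKernel.comp ((hf.comp measurable_fst).prodMk
      ((hg.comp measurable_fst).sub measurable_snd))).ennreal_ofReal
  exact this.lintegral_prod_right'

theorem measurable_opS_withDensity {X : Type*} [MeasurableSpace X] (α : ℝ) {f : X → ℝ}
    {F : X → EuclideanSpace ℝ (Fin N) → ℝ≥0∞} {g : X → EuclideanSpace ℝ (Fin N)}
    (hf : Measurable f) (hF : Measurable (Function.uncurry F)) (hg : Measurable g) :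
    Measurable fun a => opS α (f a) (volume.withDensity (F a)) (g a) := by
  have hw := measurable_wrightDensity α
  have hF' : Measurable (Function.uncurry fun (r : X × ℝ) y => F r.1 y) :=
    hF.comp ((measurable_fst.comp measurable_fst).prodMk measurable_snd)
  have h1 := measurable_heatSemigroup_withDensity (f := fun r : X × ℝ => f r.1 ^ α * r.2)
    (((hf.comp measurable_fst).pow_const α).mul measurable_snd) hF' (hg.comp measurable_fst)
  have h2 : Measurable fun r : X × ℝ => ENNReal.ofReal (r.2 * wrightDensity α r.2) := by fun_prop
  exact (h2.mul h1).lintegral_prod_right'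

theorem measurable_opP (α : ℝ) (μ : Measure (EuclideanSpace ℝ (Fin N))) [SFinite μ] :
    Measurable fun q : ℝ × EuclideanSpace ℝ (Fin N) => opP α q.1 μ q.2 := by
  have hw := measurable_wrightDensity α
  have h1 := measurable_heatSemigroup_comp μ
    (f := fun r : (ℝ × EuclideanSpace ℝ (Fin N)) × ℝ => r.1.1 ^ α * r.2) (by fun_prop)
    (measurable_snd.comp measurable_fst)
  have h2 : Measurable fun r : (ℝ × EuclideanSpace ℝ (Fin N)) × ℝ =>
      ENNReal.ofReal (wrightDensity α r.2) := by fun_prop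
  exact (h2.mul h1).lintegral_prod_right'

theorem measurable_duhamel_integrand (α p : ℝ) {u : ℝ → EuclideanSpace ℝ (Fin N) → ℝ≥0∞}
    (hu : Measurable (Function.uncurry u)) :
    Measurable fun r : (ℝ × EuclideanSpace ℝ (Fin N)) × ℝ =>
      ENNReal.ofReal ((r.1.1 - r.2) ^ (α - 1)) *
        opS α (r.1.1 - r.2) (volume.withDensity fun y => u r.2 y ^ p) r.1.2 := by
  have hF : Measurable (Function.uncurry fun (r : (ℝ × EuclideanSpace ℝ (Fin N)) × ℝ) y =>
      u r.2 y ^ p) :=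
    (hu.comp ((measurable_snd.comp measurable_fst).prodMk measurable_snd)).pow_const p
  have h1 := measurable_opS_withDensity α
    (f := fun r : (ℝ × EuclideanSpace ℝ (Fin N)) × ℝ => r.1.1 - r.2) (by fun_prop) hF
    (measurable_snd.comp measurable_fst)
  have h2 : Measurable fun r : (ℝ × EuclideanSpace ℝ (Fin N)) × ℝ =>
      ENNReal.ofReal ((r.1.1 - r.2) ^ (α - 1)) := by fun_prop
  exact h2.mul h1

theorem measurable_mildMap (α p : ℝ) (μ : Measure (EuclideanSpace ℝ (Fin N))) [SFinite μ]
    {u : ℝ → EuclideanSpace ℝ (Fin N) → ℝ≥0∞} (hu : Measurable (Function.uncurry u)) :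
    Measurable (Function.uncurry (mildMap α p μ u)) := by
  refine (measurable_opP α μ).add (Measurable.const_mul ?_ _)
  -- The domain of integration depends on t, so it is turned into a jointly measurable indicator
  -- before Tonelli measurability is used.
  have hS : MeasurableSet {r : (ℝ × EuclideanSpace ℝ (Fin N)) × ℝ | r.2 ∈ Ioo 0 r.1.1} :=
    (measurableSet_lt measurable_const measurable_snd).inter
      (measurableSet_lt measurable_snd (measurable_fst.comp measurable_fst))
  have h := ((measurable_duhamel_integrand α p hu).indicator hS).lintegral_prod_right' (ν := volume)
  convert h using 1
  funext q
  rw [← lintegral_indicator measurableSet_Ioo]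
  refine lintegral_congr fun s => ?_
  simp only [indicator, mem_ofPred_eq]

theorem mildMap_mono {α p : ℝ} (hp : 0 ≤ p) (μ : Measure (EuclideanSpace ℝ (Fin N))) :
    Monotone (mildMap α p μ) := by
  intro u v huv t x
  unfold mildMap opS heatSemigroup
  gcongr with s θ
  · exact withDensity_mono (ae_of_all _ fun y => ENNReal.rpow_le_rpow (huv s y) hp)

theorem heatSemigroup_withDensity_iSup (t : ℝ) {f : ℕ → EuclideanSpace ℝ (Fin N) → ℝ≥0∞}
    (hf : ∀ n, Measurable (f n)) (hmono : Monotone f) (x : EuclideanSpace ℝ (Fin N)) :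
    heatSemigroup t (volume.withDensity fun y => ⨆ n, f n y) x =
      ⨆ n, heatSemigroup t (volume.withDensity (f n)) x := by
  have hk : Measurable fun y => ENNReal.ofReal (heatKernel t (x - y)) :=
    (measurable_heatKernel.comp (measurable_const.prodMk
      (measurable_const.sub measurable_id))).ennreal_ofReal
  simp only [heatSemigroup_withDensity t (hf _), heatSemigroup_withDensity t (Measurable.iSup hf),
    ENNReal.iSup_mul]
  refine lintegral_iSup (fun n => (hf n).mul hk) fun m n h y => ?_
  exact mul_le_mul_left (hmono h y) _

theorem opS_withDensity_iSup (α t : ℝ) {f : ℕ → EuclideanSpace ℝ (Fin N) → ℝ≥0∞}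
    (hf : ∀ n, Measurable (f n)) (hmono : Monotone f) (x : EuclideanSpace ℝ (Fin N)) :
    opS α t (volume.withDensity fun y => ⨆ n, f n y) x =
      ⨆ n, opS α t (volume.withDensity (f n)) x := by
  have hw := measurable_wrightDensity α
  simp only [opS, heatSemigroup_withDensity_iSup _ hf hmono, ENNReal.mul_iSup]
  refine lintegral_iSup (fun n => ?_) fun m n h θ => ?_
  · exact Measurable.mul (by fun_prop)
      (measurable_heatSemigroup_comp _ (measurable_id.const_mul _) measurable_const)
  · refine mul_le_mul_right ?_ _
    exact lintegral_mono' (withDensity_mono (ae_of_all _ (hmono h))) le_rfl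

/-- Monotone convergence in each of the nested integrals; the power commutes with suprema because it
is an order isomorphism of [0, ∞]. This makes the limit of the Picard iterates a fixed point. -/
theorem mildMap_iSup {α p : ℝ} (hp : 0 < p) (μ : Measure (EuclideanSpace ℝ (Fin N)))
    {u : ℕ → ℝ → EuclideanSpace ℝ (Fin N) → ℝ≥0∞} (hu : ∀ n, Measurable (Function.uncurry (u n)))
    (hmono : Monotone u) (t : ℝ) (x : EuclideanSpace ℝ (Fin N)) :
    mildMap α p μ (fun s y => ⨆ n, u n s y) t x = ⨆ n, mildMap α p μ (u n) t x := by
  have e : ∀ s y, (⨆ n, u n s y) ^ p = ⨆ n, u n s y ^ p := fun s y =>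
    (ENNReal.orderIsoRpow p hp).map_iSup _
  have hm : ∀ s n, Measurable fun y => u n s y ^ p := fun s n =>
    ((hu n).comp measurable_prodMk_left).pow_const p
  have hmo : ∀ s, Monotone fun n y => u n s y ^ p := fun s m n h y =>
    ENNReal.rpow_le_rpow (hmono h s y) hp.le
  simp only [mildMap, e]
  rw [← ENNReal.add_iSup, ← ENNReal.mul_iSup]
  congr 2
  have e2 : ∀ s, opS α (t - s) (volume.withDensity fun y => ⨆ n, u n s y ^ p) x =
      ⨆ n, opS α (t - s) (volume.withDensity fun y => u n s y ^ p) x := fun s =>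
    opS_withDensity_iSup α (t - s) (hm s) (hmo s) x
  simp only [e2, ENNReal.mul_iSup]
  refine lintegral_iSup (fun n => ?_) fun m n h s => ?_
  · exact (measurable_duhamel_integrand α p (hu n)).comp
      (measurable_const (a := (t, x)) |>.prodMk measurable_id)
  · refine mul_le_mul_right ?_ _
    unfold opS
    refine lintegral_mono fun θ => mul_le_mul_right ?_ _
    exact lintegral_mono' (withDensity_mono (ae_of_all _ (hmo s h))) le_rfl

/-- The Picard iterates of the integral equation. -/
noncomputable def picard (α p : ℝ) (μ : Measure (EuclideanSpace ℝ (Fin N))) :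
    ℕ → ℝ → EuclideanSpace ℝ (Fin N) → ℝ≥0∞
  | 0 => fun _ _ => 0
  | n + 1 => mildMap α p μ (picard α p μ n)

theorem measurable_picard (α p : ℝ) (μ : Measure (EuclideanSpace ℝ (Fin N))) [SFinite μ] (n : ℕ) :
    Measurable (Function.uncurry (picard α p μ n)) := by
  induction n with
  | zero => exact measurable_const
  | succ n ih => exact measurable_mildMap α p μ ih

theorem picard_mono {α p : ℝ} (hp : 0 ≤ p) (μ : Measure (EuclideanSpace ℝ (Fin N))) :
    Monotone (picard α p μ) := by
  refine monotone_nat_of_le_succ fun n => ?_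
  induction n with
  | zero => exact fun _ _ => zero_le
  | succ n ih => exact mildMap_mono hp μ ih

/-- A bound on the Picard iterates in uniformly local `L^p` yields a solution. -/
theorem exists_isSolution_of_picard_bound {α p T R : ℝ} (hp : 0 < p) (hR : 0 < R)
    {μ : Measure (EuclideanSpace ℝ (Fin N))} [SFinite μ] (B : ℝ → ℝ≥0∞)
    (hB : ∀ t ∈ Ioc 0 T, B t < ∞)
    (h : ∀ n, ∀ t ∈ Ioc 0 T, ∀ z, ∫⁻ x in Metric.ball z R, picard α p μ n t x ^ p ≤ B t) :
    ∃ u : ℝ → EuclideanSpace ℝ (Fin N) → ℝ≥0∞, IsSolution α p T μ u := by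
  set u : ℝ → EuclideanSpace ℝ (Fin N) → ℝ≥0∞ := fun t x => ⨆ n, picard α p μ n t x with hu
  have hpm := measurable_picard α p μ
  have hmono := picard_mono (α := α) hp.le μ
  have hum : Measurable (Function.uncurry u) := Measurable.iSup hpm
  -- In [0, ∞] the equation holds at every point with no smallness at all; the bound B is needed
  -- only for finiteness.
  have hfix : ∀ t x, u t x = mildMap α p μ u t x := by
    intro t x
    rw [hu, mildMap_iSup hp μ hpm hmono]
    refine le_antisymm (iSup_le fun n => ?_) (iSup_le fun n => ?_)
    · exact (hmono n.le_succ t x).trans (le_iSup (fun n => mildMap α p μ (picard α p μ n) t x) n)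
    · exact le_iSup (fun n => picard α p μ n t x) (n + 1)
  have hfin : ∀ t ∈ Ioc 0 T, ∀ᵐ x, u t x < ∞ := by
    intro t ht
    have hut : Measurable fun x => u t x ^ p := (hum.comp measurable_prodMk_left).pow_const p
    have hball : ∀ z, ∀ᵐ x ∂volume.restrict (Metric.ball z R), u t x < ∞ := by
      intro z
      have hle : ∫⁻ x in Metric.ball z R, u t x ^ p ≤ B t := by
        have e : ∀ x, u t x ^ p = ⨆ n, picard α p μ n t x ^ p := fun x =>
          (ENNReal.orderIsoRpow p hp).map_iSup _
        simp only [e]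
        have hm : ∀ n, Measurable fun x => picard α p μ n t x ^ p := fun n =>
          ((hpm n).comp measurable_prodMk_left).pow_const p
        rw [lintegral_iSup hm
          (fun m n hmn x => ENNReal.rpow_le_rpow (hmono hmn t x) hp.le)]
        exact iSup_le fun n => h n t ht z
      filter_upwards [ae_lt_top hut (hle.trans_lt (hB t ht)).ne] with x hx
      by_contra hc
      rw [not_lt, top_le_iff] at hc
      rw [hc, ENNReal.top_rpow_of_pos hp] at hx
      exact lt_irrefl _ hx
    -- Countably many balls of radius R cover the space, so almost everywhere finiteness on each
    -- ball is global.
    obtain ⟨c, hc⟩ := TopologicalSpace.exists_dense_seq (EuclideanSpace ℝ (Fin N))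
    have hcov : ⋃ n, Metric.ball (c n) R = univ := by
      refine eq_univ_of_forall fun x => ?_
      obtain ⟨n, hn⟩ := hc.exists_dist_lt x hR
      exact mem_iUnion.2 ⟨n, hn⟩
    rw [← Measure.restrict_univ (μ := volume), ← hcov, ae_restrict_iUnion_iff]
    exact fun n => hball (c n)
  refine ⟨u, hum.comp (measurable_subtype_coe.prodMap measurable_id), ?_⟩
  have hset : MeasurableSet {q : ℝ × EuclideanSpace ℝ (Fin N) | u q.1 q.2 < ∞} :=
    measurableSet_lt hum measurable_const
  have hae : ∀ᵐ q : ℝ × EuclideanSpace ℝ (Fin N) ∂((volume.restrict (Ioc 0 T)).prod volume),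
      u q.1 q.2 < ∞ := by
    rw [Measure.ae_prod_iff_ae_ae hset]
    exact (ae_restrict_iff' measurableSet_Ioc).2 (ae_of_all _ hfin)
  filter_upwards [hae] with q hq
  exact ⟨hq, hfix q.1 q.2⟩

/-! ### A priori bounds in the weighted space -/

theorem lintegral_add_rpow_le {X : Type*} [MeasurableSpace X] {ν : Measure X} {p : ℝ} (hp : 1 ≤ p)
    {f g : X → ℝ≥0∞} (hf : Measurable f) (hg : Measurable g) {a b : ℝ≥0∞}
    (ha : ∫⁻ x, f x ^ p ∂ν ≤ a ^ p) (hb : ∫⁻ x, g x ^ p ∂ν ≤ b ^ p) :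
    ∫⁻ x, (f x + g x) ^ p ∂ν ≤ (a + b) ^ p := by
  have hp0 : 0 < p := by linarith
  have root : ∀ {y c : ℝ≥0∞}, y ≤ c ^ p → y ^ (1 / p) ≤ c := by
    intro y c h
    rw [one_div]
    exact (ENNReal.rpow_inv_le_iff hp0).2 h
  have h := (ENNReal.lintegral_Lp_add_le hf.aemeasurable hg.aemeasurable hp).trans
    (add_le_add (root ha) (root hb))
  rw [one_div, ENNReal.rpow_inv_le_iff hp0] at h
  exact h

/-- The smoothing effect of `P_α(t)` and `S_α(t)`, uniformly in `α`. -/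
theorem exists_opP_opS_bound (hN : 1 ≤ N) {p β : ℝ} (hp : 1 < p) (hβ : 2 * β * p = N * (p - 1))
    (hβ0 : 0 ≤ β) (hβ1 : β < 1) :
    ∃ C : ℝ, 0 < C ∧ ∀ (ν : Measure (EuclideanSpace ℝ (Fin N))) [SFinite ν] (α t T A : ℝ),
      0 < α → α < 1 → 0 < A → 0 < t → t ≤ T →
      (∀ z, ν (Metric.ball z (T ^ (α / 2))) ≤ ENNReal.ofReal A) →
      ∀ z, (∫⁻ x in Metric.ball z (T ^ (α / 2)), opP α t ν x ^ p ≤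
          ENNReal.ofReal (C * A * t ^ (-(α * β))) ^ p) ∧
        ∫⁻ x in Metric.ball z (T ^ (α / 2)), opS α t ν x ^ p ≤
          ENNReal.ofReal (C * A * t ^ (-(α * β))) ^ p := by
  have hp0 : 0 < p := by linarith
  obtain ⟨C₀, hC₀, H⟩ := exists_setLIntegral_average_heatSemigroup_le hN hp hβ
  obtain ⟨C₁, hC₁, HM⟩ := exists_wrightDensity_moment_bound hβ0 hβ1
  refine ⟨C₀ * C₁, by positivity, fun ν _ α t T A hα hα1 hA ht htT hν z => ?_⟩
  have hw := measurable_wrightDensity α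
  have e : ENNReal.ofReal (C₀ * t ^ (-(α * β))) * ENNReal.ofReal A * ENNReal.ofReal C₁ =
      ENNReal.ofReal (C₀ * C₁ * A * t ^ (-(α * β))) := by
    rw [← ENNReal.ofReal_mul (by positivity), ← ENNReal.ofReal_mul (by positivity)]
    congr 1; ring
  have hA0 : ENNReal.ofReal A ≠ 0 := by simpa using hA
  constructor
  · refine (H ν (ENNReal.ofReal A) α t T (fun θ => ENNReal.ofReal (wrightDensity α θ))
      hA0 ENNReal.ofReal_ne_top hα ht htT (by fun_prop) hν z).trans ?_
    refine ENNReal.rpow_le_rpow ?_ hp0.le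
    rw [← e]
    exact mul_le_mul_right (HM α hα hα1).1 _
  · refine (H ν (ENNReal.ofReal A) α t T (fun θ => ENNReal.ofReal (θ * wrightDensity α θ))
      hA0 ENNReal.ofReal_ne_top hα ht htT (by fun_prop) hν z).trans ?_
    refine ENNReal.rpow_le_rpow ?_ hp0.le
    rw [← e]
    exact mul_le_mul_right (HM α hα hα1).2 _

theorem measurable_duhamel_integrand_fixed_time (α p t : ℝ)
    {u : ℝ → EuclideanSpace ℝ (Fin N) → ℝ≥0∞} (hu : Measurable (Function.uncurry u)) :
    Measurable fun r : ℝ × EuclideanSpace ℝ (Fin N) =>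
      ENNReal.ofReal ((t - r.1) ^ (α - 1)) *
        opS α (t - r.1) (volume.withDensity fun y => u r.1 y ^ p) r.2 := by
  have hF : Measurable (Function.uncurry fun (r : ℝ × EuclideanSpace ℝ (Fin N)) y =>
      u r.1 y ^ p) :=
    (hu.comp ((measurable_fst.comp measurable_fst).prodMk measurable_snd)).pow_const p
  have h1 := measurable_opS_withDensity α
    (f := fun r : ℝ × EuclideanSpace ℝ (Fin N) => t - r.1) (by fun_prop) hF measurable_snd
  have h2 : Measurable fun r : ℝ × EuclideanSpace ℝ (Fin N) =>
      ENNReal.ofReal ((t - r.1) ^ (α - 1)) := by fun_prop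
  exact h2.mul h1

/-- The Duhamel integral maps a ball of the weighted space `L^∞(0, T; L^p_uloc)` into a ball. -/
theorem exists_duhamel_bound (hN : 1 ≤ N) {p β : ℝ} (hp : 1 < p) (hβ : 2 * β * p = N * (p - 1))
    (hβ0 : 0 ≤ β) (hβp : β * p ≤ 1) :
    ∃ C : ℝ, 0 < C ∧ ∀ (α T K : ℝ)
      (u : ℝ → EuclideanSpace ℝ (Fin N) → ℝ≥0∞), 0 < α → α < 1 → 0 < K →
      Measurable (Function.uncurry u) →
      (∀ s ∈ Ioc 0 T, ∀ z, ∫⁻ x in Metric.ball z (T ^ (α / 2)), u s x ^ p ≤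
        ENNReal.ofReal (K * s ^ (-(α * β))) ^ p) →
      ∀ t ∈ Ioc 0 T, ∀ z, ∫⁻ x in Metric.ball z (T ^ (α / 2)),
        (ENNReal.ofReal α * ∫⁻ s in Ioo 0 t, ENNReal.ofReal ((t - s) ^ (α - 1)) *
          opS α (t - s) (volume.withDensity fun y => u s y ^ p) x) ^ p ≤
        ENNReal.ofReal (C * (K ^ p * T ^ (α * (1 - β * p)) / (1 - α * (β * p))) *
          t ^ (-(α * β))) ^ p := by
  have hp0 : 0 < p := by linarith
  have hβ1 : β < 1 := by nlinarith
  obtain ⟨C₀, hC₀, H⟩ := exists_opP_opS_bound hN hp hβ hβ0 hβ1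
  have hb1 : 0 < 1 - β := by linarith
  refine ⟨C₀ * (2 + 2 / (1 - β)), by positivity,
    fun α T K u hα hα1 hK hu hus t ht z => ?_⟩
  have ht0 : 0 < t := ht.1
  have hT : 0 < T := ht0.trans_le ht.2
  -- Exponents of the beta integral: (t - s)^(α - 1) times the smoothing (t - s)^(-αβ) is (t - s)^(a
  -- - 1), and (s^(-αβ))^p is s^(b - 1). From βp ≤ 1 and α < 1 one gets b > 0, including the
  -- critical case βp = 1, where b = 1 - α.
  set a : ℝ := α * (1 - β) with ha
  set b : ℝ := 1 - α * (β * p) with hb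
  have ha0 : 0 < a := by positivity
  have ha1 : a ≤ 1 := by nlinarith
  have hb0 : 0 < b := by nlinarith [mul_nonneg hβ0 hp0.le]
  have hb1' : b ≤ 1 := by
    have : 0 ≤ α * (β * p) := by positivity
    linarith
  have hS : ∀ s ∈ Ioo 0 t, ∫⁻ x in Metric.ball z (T ^ (α / 2)),
      (ENNReal.ofReal ((t - s) ^ (α - 1)) *
        opS α (t - s) (volume.withDensity fun y => u s y ^ p) x) ^ p ≤
      (ENNReal.ofReal (C₀ * K ^ p) *
        ENNReal.ofReal ((t - s) ^ (a - 1) * s ^ (b - 1))) ^ p := by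
    intro s hs
    have hs0 : 0 < s := hs.1
    have hts : 0 < t - s := sub_pos.2 hs.2
    have hKs : 0 < K * s ^ (-(α * β)) := by positivity
    -- The L^p bound on u(s) is a mass bound on u(s)^p dx, so the estimate for measures applies
    -- again.
    have hν : ∀ z', (volume.withDensity fun y => u s y ^ p) (Metric.ball z' (T ^ (α / 2))) ≤
        ENNReal.ofReal ((K * s ^ (-(α * β))) ^ p) := by
      intro z'
      rw [withDensity_apply _ Metric.isOpen_ball.measurableSet, ← ENNReal.ofReal_rpow_of_pos hKs]
      exact hus s ⟨hs0, hs.2.le.trans ht.2⟩ z'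
    have h := (H (volume.withDensity fun y => u s y ^ p) α (t - s) T _ hα hα1 (by positivity)
      hts (by linarith [ht.2]) hν z).2
    simp only [ENNReal.mul_rpow_of_nonneg _ _ hp0.le]
    rw [lintegral_const_mul' _ _ (ENNReal.rpow_ne_top_of_nonneg hp0.le ENNReal.ofReal_ne_top)]
    refine (mul_le_mul_right h _).trans (le_of_eq ?_)
    rw [← ENNReal.mul_rpow_of_nonneg _ _ hp0.le, ← ENNReal.mul_rpow_of_nonneg _ _ hp0.le,
      ← ENNReal.ofReal_mul (by positivity), ← ENNReal.ofReal_mul (by positivity)]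
    congr 2
    rw [show a - 1 = (α - 1) + -(α * β) by rw [ha]; ring,
      show b - 1 = -(α * β) * p by rw [hb]; ring, Real.rpow_add hts,
      Real.rpow_mul hs0.le, Real.mul_rpow hK.le (by positivity)]
    ring
  have hD := lintegral_rpow_lintegral_le (ν := volume.restrict (Metric.ball z (T ^ (α / 2))))
    (κ := volume.restrict (Ioo 0 t)) hp
    (f := fun s x => ENNReal.ofReal ((t - s) ^ (α - 1)) *
        opS α (t - s) (volume.withDensity fun y => u s y ^ p) x)
    (measurable_duhamel_integrand_fixed_time α p t hu)
    (c := fun s => ENNReal.ofReal (C₀ * K ^ p) *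
        ENNReal.ofReal ((t - s) ^ (a - 1) * s ^ (b - 1))) (by fun_prop)
    ((ae_restrict_iff' measurableSet_Ioo).2 (ae_of_all _ fun s hs => ?_))
    (ae_of_all _ fun s => ENNReal.mul_ne_top ENNReal.ofReal_ne_top ENNReal.ofReal_ne_top)
    ((ae_restrict_iff' measurableSet_Ioo).2 (ae_of_all _ hS))
  swap
  · have hs0 : 0 < s := hs.1
    have hts : 0 < t - s := sub_pos.2 hs.2
    refine mul_ne_zero ?_ ?_ <;> simp only [ne_eq, ENNReal.ofReal_eq_zero, not_le] <;> positivity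
  have hC : ENNReal.ofReal α * ∫⁻ s in Ioo 0 t, ENNReal.ofReal (C₀ * K ^ p) *
      ENNReal.ofReal ((t - s) ^ (a - 1) * s ^ (b - 1)) ≤
      ENNReal.ofReal (C₀ * (2 + 2 / (1 - β)) * (K ^ p * T ^ (α * (1 - β * p)) / b) *
        t ^ (-(α * β))) := by
    rw [lintegral_const_mul _ (by fun_prop)]
    refine (mul_le_mul_right (mul_le_mul_right
      (lintegral_beta_le ht0 ha0 ha1 hb0 hb1') _) _).trans ?_
    rw [← ENNReal.ofReal_mul (by positivity), ← ENNReal.ofReal_mul (by positivity)]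
    refine ENNReal.ofReal_le_ofReal ?_
    have e1 : t ^ (a + b - 1) = t ^ (α * (1 - β * p)) * t ^ (-(α * β)) := by
      rw [← Real.rpow_add ht0]; congr 1; rw [ha, hb]; ring
    -- The exponent is nonnegative because βp ≤ 1, that is, p ≤ p_F.
    have e2 : t ^ (α * (1 - β * p)) ≤ T ^ (α * (1 - β * p)) :=
      Real.rpow_le_rpow ht0.le ht.2 (mul_nonneg hα.le (by linarith))
    -- The prefactor α cancels the pole of 1/a as α → 0, since α/a = 1/(1 - β); only 1/b remains.
    have e3 : α * (2 * (1 / a + 1 / b)) ≤ (2 + 2 / (1 - β)) / b := by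
      have : α * (2 * (1 / a + 1 / b)) = 2 / (1 - β) + 2 * α / b := by
        rw [ha]; field_simp
      rw [this, add_div, add_comm]
      have h1 : 2 * α / b ≤ 2 / b := by gcongr; linarith
      have h2 : 2 / (1 - β) ≤ 2 / (1 - β) / b := le_div_self (by positivity) hb0 hb1'
      linarith
    rw [e1]
    calc _ = C₀ * K ^ p * t ^ (-(α * β)) *
          (t ^ (α * (1 - β * p)) * (α * (2 * (1 / a + 1 / b)))) := by ring
      _ ≤ C₀ * K ^ p * t ^ (-(α * β)) *
          (T ^ (α * (1 - β * p)) * ((2 + 2 / (1 - β)) / b)) := by gcongr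
      _ = _ := by ring
  simp only [ENNReal.mul_rpow_of_nonneg _ _ hp0.le]
  rw [lintegral_const_mul' _ _ (ENNReal.rpow_ne_top_of_nonneg hp0.le ENNReal.ofReal_ne_top)]
  refine (mul_le_mul_right hD _).trans ?_
  rw [← ENNReal.mul_rpow_of_nonneg _ _ hp0.le]
  exact ENNReal.rpow_le_rpow hC hp0.le

/-- The integral equation maps a ball of the weighted space `L^∞(0, T; L^p_uloc)` into a ball. -/
theorem exists_mildMap_bound (hN : 1 ≤ N) {p β : ℝ} (hp : 1 < p) (hβ : 2 * β * p = N * (p - 1))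
    (hβ0 : 0 ≤ β) (hβp : β * p ≤ 1) :
    ∃ C : ℝ, 0 < C ∧ ∀ (μ : Measure (EuclideanSpace ℝ (Fin N))) [SFinite μ] (α T A K : ℝ)
      (u : ℝ → EuclideanSpace ℝ (Fin N) → ℝ≥0∞), 0 < α → α < 1 → 0 < A → 0 < K →
      Measurable (Function.uncurry u) →
      (∀ z, μ (Metric.ball z (T ^ (α / 2))) ≤ ENNReal.ofReal A) →
      (∀ s ∈ Ioc 0 T, ∀ z, ∫⁻ x in Metric.ball z (T ^ (α / 2)), u s x ^ p ≤
        ENNReal.ofReal (K * s ^ (-(α * β))) ^ p) →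
      ∀ t ∈ Ioc 0 T, ∀ z, ∫⁻ x in Metric.ball z (T ^ (α / 2)), mildMap α p μ u t x ^ p ≤
        ENNReal.ofReal (C * (A + K ^ p * T ^ (α * (1 - β * p)) / (1 - α * (β * p))) *
          t ^ (-(α * β))) ^ p := by
  have hp0 : 0 < p := by linarith
  have hβ1 : β < 1 := by nlinarith
  obtain ⟨C₀, hC₀, H₀⟩ := exists_opP_opS_bound hN hp hβ hβ0 hβ1
  obtain ⟨C₁, hC₁, H₁⟩ := exists_duhamel_bound hN hp hβ hβ0 hβp
  refine ⟨C₀ + C₁, by positivity,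
    fun μ _ α T A K u hα hα1 hA hK hu hμ hus t ht z => ?_⟩
  have ht0 : 0 < t := ht.1
  have hT : 0 < T := ht0.trans_le ht.2
  have hb0 : 0 < 1 - α * (β * p) := by nlinarith [mul_nonneg hβ0 hp0.le]
  have hg : Measurable fun x => ENNReal.ofReal α * ∫⁻ s in Ioo 0 t,
      ENNReal.ofReal ((t - s) ^ (α - 1)) *
        opS α (t - s) (volume.withDensity fun y => u s y ^ p) x :=
    Measurable.const_mul (measurable_duhamel_integrand_fixed_time α p t hu).lintegral_prod_left' _
  have hf : Measurable fun x => opP α t μ x :=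
    (measurable_opP α μ).comp (g := fun q : ℝ × EuclideanSpace ℝ (Fin N) => opP α q.1 μ q.2)
      (f := fun x => (t, x)) measurable_prodMk_left
  refine (lintegral_add_rpow_le hp.le hf hg (H₀ μ α t T A hα hα1 hA ht0 ht.2 hμ z).1
    (H₁ α T K u hα hα1 hK hu hus t ht z)).trans (ENNReal.rpow_le_rpow ?_ hp0.le)
  set X : ℝ := K ^ p * T ^ (α * (1 - β * p)) / (1 - α * (β * p)) with hX
  have hXp : 0 ≤ X := by positivity
  rw [← ENNReal.ofReal_add (by positivity) (by positivity)]
  refine ENNReal.ofReal_le_ofReal ?_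
  rw [← add_mul]
  gcongr
  have := mul_nonneg hC₀.le hXp
  have := mul_nonneg hC₁.le hA.le
  linarith

/-! ### The smallness condition and the choice of γ₂ -/

/-- Existence of solutions for small uniformly local initial measures. -/
theorem exists_isSolution_of_small (hN : 1 ≤ N) {p : ℝ} (hp : 1 < p) (hpF : p ≤ fujitaExponent N) :
    ∃ c : ℝ, 0 < c ∧ ∀ α e T : ℝ, 0 < α → α < 1 → 0 < T → 0 < e →
      e ^ (p - 1) ≤ 1 - α * ((N : ℝ) / 2 * (p - 1)) →
      ∀ (μ : Measure (EuclideanSpace ℝ (Fin N))) [SFinite μ],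
        (∀ z, μ (Metric.ball z (T ^ (α / 2))) ≤
          ENNReal.ofReal (c * e * T ^ (α * ((N : ℝ) / 2 - 1 / (p - 1))))) →
        ∃ u : ℝ → EuclideanSpace ℝ (Fin N) → ℝ≥0∞, IsSolution α p T μ u := by
  have hp0 : 0 < p := by linarith
  have hp1 : 0 < p - 1 := by linarith
  have hN0 : (0 : ℝ) < N := by exact_mod_cast hN
  set β : ℝ := N * (p - 1) / (2 * p) with hβdef
  have hβp : β * p = (N : ℝ) / 2 * (p - 1) := by rw [hβdef]; field_simp
  have hβ : 2 * β * p = N * (p - 1) := by rw [mul_assoc, hβp]; ring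
  have hβp1 : β * p ≤ 1 := by
    rw [hβp]
    unfold fujitaExponent at hpF
    calc (N : ℝ) / 2 * (p - 1) ≤ N / 2 * (2 / N) := by gcongr; linarith
      _ = 1 := by field_simp
  obtain ⟨C, hC, H⟩ := exists_mildMap_bound hN hp hβ (by positivity) hβp1
  -- The ball K = 2CA is invariant if K^p T^(α(1-βp)) / (1 - αβp) ≤ A, that is, A^(p-1) ≤ (2C)^(-p)
  -- T^(-α(1-βp)) (1 - αβp). Taking the root of order p - 1 gives this constant and the stated power
  -- of T, with e accounting for 1 - αβp.
  refine ⟨(2 * C) ^ (-(p / (p - 1))), by positivity, fun α e T hα hα1 hT he hsmall μ _ hμ => ?_⟩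
  rw [← hβp] at hsmall
  have hb : 0 < 1 - α * (β * p) := lt_of_lt_of_le (by positivity) hsmall
  set A : ℝ := (2 * C) ^ (-(p / (p - 1))) * e * T ^ (α * ((N : ℝ) / 2 - 1 / (p - 1))) with hA
  have hA0 : 0 < A := by positivity
  have hAp : A ^ (p - 1) = (2 * C) ^ (-p) * e ^ (p - 1) * T ^ (-(α * (1 - β * p))) := by
    rw [hA, Real.mul_rpow (by positivity) (by positivity),
      Real.mul_rpow (by positivity) (by positivity), ← Real.rpow_mul (by positivity),
      ← Real.rpow_mul hT.le]
    congr 3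
    · field_simp
    · rw [hβp]; field_simp; ring
  have hX : (2 * C * A) ^ p * T ^ (α * (1 - β * p)) / (1 - α * (β * p)) ≤ A := by
    have e1 : A ^ p = A ^ (p - 1) * A := by
      nth_rewrite 3 [← Real.rpow_one A]
      rw [← Real.rpow_add hA0, sub_add_cancel]
    rw [div_le_iff₀ hb, Real.mul_rpow (by positivity) hA0.le, e1, hAp, Real.rpow_neg (by positivity),
      Real.rpow_neg hT.le]
    have q1 : 0 < (2 * C) ^ p := by positivity
    have q2 : 0 < T ^ (α * (1 - β * p)) := by positivity
    calc _ = A * e ^ (p - 1) := by field_simp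
      _ ≤ _ := by gcongr
  refine exists_isSolution_of_picard_bound (R := T ^ (α / 2)) hp0 (by positivity)
    (fun t => ENNReal.ofReal (2 * C * A * t ^ (-(α * β))) ^ p)
    (fun t _ => ENNReal.rpow_lt_top_of_nonneg hp0.le ENNReal.ofReal_ne_top) fun n => ?_
  induction n with
  | zero => intro t _ z; simp [picard, hp0]
  | succ n ih =>
    intro t ht z
    have ht0 : 0 < t := ht.1
    refine (H μ α T A (2 * C * A) (picard α p μ n) hα hα1 hA0 (by positivity)
      (measurable_picard α p μ n) hμ ih t ht z).trans ?_
    refine ENNReal.rpow_le_rpow (ENNReal.ofReal_le_ofReal ?_) hp0.le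
    refine mul_le_mul_of_nonneg_right ?_ (by positivity)
    have := mul_le_mul_of_nonneg_left hX hC.le
    linarith

/-- The hypotheses on N and p are moved inside the existential, with dummy value 1 outside their
range, so that the constant can be chosen as a function of N and p alone, before α. -/
theorem exists_smallness_constant (N : ℕ) (p : ℝ) : ∃ c : ℝ, 0 < c ∧
    (1 ≤ N → 1 < p → p ≤ fujitaExponent N → ∀ α e T : ℝ, 0 < α → α < 1 → 0 < T → 0 < e →
      e ^ (p - 1) ≤ 1 - α * ((N : ℝ) / 2 * (p - 1)) →
      ∀ (μ : Measure (EuclideanSpace ℝ (Fin N))) [SFinite μ],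
        (∀ z, μ (Metric.ball z (T ^ (α / 2))) ≤
          ENNReal.ofReal (c * e * T ^ (α * ((N : ℝ) / 2 - 1 / (p - 1))))) →
        ∃ u : ℝ → EuclideanSpace ℝ (Fin N) → ℝ≥0∞, IsSolution α p T μ u) := by
  by_cases h : 1 ≤ N ∧ 1 < p ∧ p ≤ fujitaExponent N
  · obtain ⟨c, hc, H⟩ := exists_isSolution_of_small h.1 h.2.1 h.2.2
    exact ⟨c, hc, fun _ _ _ => H⟩
  · exact ⟨1, one_pos, fun h1 h2 h3 => absurd ⟨h1, h2, h3⟩ h⟩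

end TimeFractional

theorem theorem1p2 :
    ∃ γ₂ : ℕ → ℝ → ℝ → ℝ,
      (∀ (N : ℕ) (p α : ℝ), 1 ≤ N → 1 < p → p ≤ TimeFractional.fujitaExponent N → 0 < α → α < 1 →
        0 < γ₂ N p α ∧
        ∀ T : ℝ, 0 < T →
          ∀ (μ : Measure (EuclideanSpace ℝ (Fin N))) [IsLocallyFiniteMeasure μ],
            (⨆ z, μ (Metric.ball z (T ^ (α / 2)))) ≤
              ENNReal.ofReal (γ₂ N p α * T ^ (α * ((N : ℝ) / 2 - 1 / (p - 1)))) →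
            ∃ u : ℝ → EuclideanSpace ℝ (Fin N) → ℝ≥0∞, TimeFractional.IsSolution α p T μ u) ∧
      (∀ (N : ℕ) (p : ℝ), 1 ≤ N → 1 < p → p < TimeFractional.fujitaExponent N →
        Filter.limsup (fun α : ℝ => ((γ₂ N p α : ℝ) : EReal)) (𝓝[<] (1 : ℝ)) ∈
          Ioo (0 : EReal) ⊤) ∧
      (∀ N : ℕ, 1 ≤ N → ∃ c C : ℝ, 0 < c ∧ 0 < C ∧
        (∀ α : ℝ, 0 < α → α < 1 →
          γ₂ N (TimeFractional.fujitaExponent N) α ≤ C * (1 - α) ^ ((N : ℝ) / 2)) ∧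
        ∀ᶠ α : ℝ in 𝓝[<] (1 : ℝ),
          c * (1 - α) ^ ((N : ℝ) / 2) ≤ γ₂ N (TimeFractional.fujitaExponent N) α) := by
  choose c hc H using TimeFractional.exists_smallness_constant
  have hsub : ∀ (N : ℕ) (p : ℝ), 1 ≤ N → p < TimeFractional.fujitaExponent N →
      0 < 1 - (N : ℝ) / 2 * (p - 1) := by
    intro N p hN hpF
    have hN0 : (0 : ℝ) < N := by exact_mod_cast hN
    unfold TimeFractional.fujitaExponent at hpF
    have : (N : ℝ) / 2 * (p - 1) < N / 2 * (2 / N) := by gcongr; linarith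
    rw [show (N : ℝ) / 2 * (2 / N) = 1 by field_simp] at this
    linarith
  -- The largest admissible e is (1 - αβp)^(1/(p-1)) with βp = N(p - 1)/2. At p_F this is (1 -
  -- α)^(N/2). Below p_F its value at α = 1 is used instead: it is smaller, still positive, and
  -- independent of α.
  refine ⟨fun N p α => c N p * if p = TimeFractional.fujitaExponent N then (1 - α) ^ ((N : ℝ) / 2)
    else (1 - (N : ℝ) / 2 * (p - 1)) ^ (1 / (p - 1)), ?_, ?_, ?_⟩
  · intro N p α hN hp hpF hα hα1
    have hN0 : (0 : ℝ) < N := by exact_mod_cast hN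
    have hp1 : 0 < p - 1 := by linarith
    have hα' : 0 < 1 - α := by linarith
    beta_reduce
    split_ifs with h
    · have hNp : (N : ℝ) / 2 * (p - 1) = 1 := by
        rw [h, TimeFractional.fujitaExponent]; field_simp; ring
      refine ⟨mul_pos (hc N p) (by positivity), fun T hT μ _ hμ => ?_⟩
      refine H N p hN hp hpF α _ T hα hα1 hT (by positivity) ?_ μ fun z => (le_iSup _ z).trans hμ
      rw [← Real.rpow_mul hα'.le, hNp, Real.rpow_one, mul_one]
    · have hs := hsub N p hN (lt_of_le_of_ne hpF h)
      refine ⟨mul_pos (hc N p) (by positivity), fun T hT μ _ hμ => ?_⟩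
      refine H N p hN hp hpF α _ T hα hα1 hT (by positivity) ?_ μ fun z => (le_iSup _ z).trans hμ
      rw [← Real.rpow_mul hs.le, one_div_mul_cancel hp1.ne', Real.rpow_one]
      have : 0 < (N : ℝ) / 2 * (p - 1) := by positivity
      nlinarith
  · intro N p hN hp hpF
    simp only [hpF.ne, if_false]
    -- For fixed N and p the function is constant in α. The limsup is taken in `EReal`, so its
    -- finiteness is not an artefact of a default value.
    rw [limsup_const]
    have hs := hsub N p hN hpF
    exact ⟨EReal.coe_pos.2 (mul_pos (hc N p) (by positivity)), EReal.coe_lt_top _⟩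
  · intro N hN
    -- At p_F the definition is an equality, so one constant serves for both bounds.
    refine ⟨c N _, c N _, hc N (TimeFractional.fujitaExponent N),
      hc N (TimeFractional.fujitaExponent N), fun α _ _ => ?_, Eventually.of_forall fun α => ?_⟩
    · simp
    · simp
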